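/- Let $K$ be a perfect field and let $F\in K[[x]][y]$ be a square-free Weierstrass polynomial of degree $d$ in $y$ (monic, all other coefficients vanishing at $x=0$). Assume that $K$ has characteristic $0$ or greater than $d$. Let $\mathrm{val}$ be the $x$-valuation, with $\mathrm{val}(\sum_i a_i(x)y^i)=\min_i \mathrm{val}(a_i)$. **Newton polygon and edge data.** The Newton polygon $\mathcal N(G)$ of $G=\sum_{i,j} a_{ij}x^jy^i$ of degree $n$ in $y$ is the lower convex hull of the points $(i,\mathrm{val}(\sum_j a_{ij}x^j))$, $0\le i\le n$ (points with infinite second coordinate are omitted; the lower convex hull is the lower boundary of the convex hull). A Weierstrass polynomial $G\in L[[x]][y]$ over a field $L$ is *degenerated*, with *edge data* $(q,m,P,N)$, if $\mathcal N(G)$ is straight of slope $-m/q$ with $q>0$ and $q,m$ coprime, and $$\sum_{(i,j)\in\mathcal N(G)}a_{ij}x^jy^i=c\,\bigl(P(y^q/x^m)\,x^{m\deg P}\bigr)^N$$ with $c\in L^\times$, $N\ge 1$ and $P\in L[Z]$ monic irreducible. **Newton–Puiseux transforms.** Let $K_0=K$, $N_0=d$, $c_0=-\mathrm{coeff}(F,y^{d-1})/d$,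 $H_0=F(x,y+c_0(x))$ and $\pi_0(x,y)=(x,y+c_0(x))$. For $k\ge1$, if $H_{k-1}\in K_{k-1}[[x]][y]$ has degree $N_{k-1}\neq1$ and is degenerated with edge data $(q_k,m_k,P_k,N_k)$, let $\ell_k=\deg P_k$, $K_k=K_{k-1}[Z]/(P_k)$, let $z_k$ be the class of $Z$, and let $s_k,t_k$ be the integers with $q_ks_k-t_km_k=1$, $0\le t_k<q_k$. Let $G_k\in K_k[[x]][y]$ be the Weierstrass polynomial (of degree $N_k$) with $$H_{k-1}\bigl(z_k^{t_k}x^{q_k},x^{m_k}(y+z_k^{s_k})\bigr)=x^{q_km_k\ell_kN_k}\,G_k\,V_k,\qquad V_k\in K_k[[x,y]]^\times,$$ let $c_k=-\mathrm{coeff}(G_k,y^{N_k-1})/N_k$, $H_k=G_k(x,y+c_k(x))$, and $\pi_k=\pi_{k-1}\circ\sigma_k$ with $\sigma_k(x,y)=(z_k^{t_k}x^{q_k},\,x^{m_k}(y+z_k^{s_k}+c_k(x)))$. Let $g$ be the first index such that $N_g=1$ or $H_g$ is not degenerated. **Valuations and minimal polynomials.** For $0\le k\le g$ let $v_k(H)=\mathrm{val}(\pi_k^*H)$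 for $H\in K[[x]][y]$. Write $\pi_k(x,0)=(\mu_kx^{e_k},S_k(x))$; let $\phi_k\in K[[x]][y]$ be the minimal polynomial of $S_k\in K_k[[x]]$ over $K[[x]]$, where $K[[x]]$ acts through $x\mapsto\mu_kx^{e_k}$ (so $\phi_k(\mu_kx^{e_k},S_k(x))=0$). Put $\phi_{-1}=x$. **Theorem.** Let $0\le k\le g$ with $N_k>1$. Let $\mathcal B$ be the set of $B=(b_{-1},\dots,b_k)\in\mathbb N^{k+2}$ with $b_{i-1}<q_i\ell_i$ for $1\le i\le k$, and put $\Phi^B=\prod_{i=-1}^k\phi_i^{b_i}$. Then $F$ has a unique $\Phi$-adic expansion $$F=\sum_{B\in\mathcal B}f_B\Phi^B,\qquad f_B\in K$$ (with finitely many tails $(b_0,\dots,b_k)$ and arbitrary powers of $\phi_{-1}=x$). Let $V=(v_k(\phi_{-1}),\dots,v_k(\phi_k))$ and, for $0\le i\le N_k$, $$w_i=\min\{\langle B,V\rangle : b_k=i,\ f_B\ne0\}-v_k(F),$$ with $w_i=\infty$ if the set is empty. Then the Newton polygon of $H_k$ is the lower convex hull of the points $(i,w_i)$, $0\le i\le N_k$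 (points with $w_i=\infty$ being omitted). -/

import Mathlib

/-! Elements of `K[[x]][y]` are `Polynomial (PowerSeries K)`: the power series variable is `x`,
the polynomial variable is `y`. -/

universe u

namespace NewtonPuiseux

noncomputable section

/-! ### Weierstrass polynomials and Newton polygons -/

/-- A Weierstrass polynomial: monic in `y`, and all other coefficients vanish at `x = 0`. -/
def IsWeierstrass {L : Type u} [Field L] (G : Polynomial (PowerSeries L)) : Prop :=
  G.Monic ∧ ∀ i < G.natDegree, PowerSeries.constantCoeff (G.coeff i) = 0

/-- The lower convex hull of a set of points of the plane: the points of the convex hull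
with no point of the convex hull vertically below them. -/
def lowerConvexHull (S : Set (ℝ × ℝ)) : Set (ℝ × ℝ) :=
  {p | p ∈ convexHull ℝ S ∧ ∀ t : ℝ, (p.1, t) ∈ convexHull ℝ S → p.2 ≤ t}

/-- The points `(i, u i)`, `0 ≤ i ≤ n`, those with `u i = ∞` being left out. -/
def graphPoints (n : ℕ) (u : ℕ → WithTop ℤ) : Set (ℝ × ℝ) :=
  {p | ∃ i ≤ n, ∃ j : ℤ, u i = (j : WithTop ℤ) ∧ p = ((i : ℝ), (j : ℝ))}

/-- The Newton polygon of `∑ aᵢ(x) yⁱ`: the lower convex hull of the points `(i, val aᵢ)`. -/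
def newtonPolygon {L : Type u} [Field L] (G : Polynomial (PowerSeries L)) : Set (ℝ × ℝ) :=
  lowerConvexHull (graphPoints G.natDegree
    (fun i => ENat.map (fun n : ℕ => (n : ℤ)) (G.coeff i).order))

open Classical in
/-- The boundary polynomial: the sum of the terms `aᵢⱼ xʲ yⁱ` with `(i, j)` on the
Newton polygon. -/
def boundaryPolynomial {L : Type u} [Field L] (G : Polynomial (PowerSeries L)) :
    Polynomial (PowerSeries L) :=
  ∑ i ∈ Finset.range (G.natDegree + 1), Polynomial.monomial i
    (PowerSeries.mk fun j =>
      if ((i : ℝ), (j : ℝ)) ∈ newtonPolygon G then PowerSeries.coeff j (G.coeff i) else 0)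

/-- The quasi-homogeneous polynomial `P(y^q / x^m) x^(m deg P)`. -/
def quasiHomogeneous {L : Type u} [Field L] (q m : ℕ) (P : Polynomial L) :
    Polynomial (PowerSeries L) :=
  ∑ j ∈ Finset.range (P.natDegree + 1), Polynomial.monomial (q * j)
    (PowerSeries.monomial (m * (P.natDegree - j)) (P.coeff j))

/-- Edge data `(q, m, P, N)` of a degenerated Weierstrass polynomial `G`: the Newton polygon is
straight of slope `-m/q` and the boundary polynomial is
`c (P(y^q / x^m) x^(m deg P))^N` with `P` monic irreducible. -/
structure EdgeData {L : Type u} [Field L] (G : Polynomial (PowerSeries L)) where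
  q : ℕ
  m : ℕ
  P : Polynomial L
  N : ℕ
  q_pos : 0 < q
  N_pos : 0 < N
  coprime : Nat.Coprime q m
  monic : P.Monic
  irreducible : Irreducible P
  straight : ∃ b : ℝ, ∀ p ∈ newtonPolygon G, (m : ℝ) * p.1 + (q : ℝ) * p.2 = b
  boundary : ∃ c : L, c ≠ 0 ∧
    boundaryPolynomial G = Polynomial.C (PowerSeries.C c) * quasiHomogeneous q m P ^ N

/-- `G` is degenerated over `L`. -/
def IsDegenerated {L : Type u} [Field L] (G : Polynomial (PowerSeries L)) : Prop :=
  Nonempty (EdgeData G)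

/-! ### The Newton–Puiseux transforms -/

/-- For `G` of degree `N`, the power series `c = - coeff(G, y^(N-1)) / N`; the polynomial
`G(x, y + c(x))` has no term of degree `N - 1`. -/
def shift {L : Type u} [Field L] (G : Polynomial (PowerSeries L)) : PowerSeries L :=
  PowerSeries.C (-(G.natDegree : L)⁻¹) * G.coeff (G.natDegree - 1)

/-- The ring homomorphism `L[[x]] → L'[[x]]`, `a(x) ↦ a(μ x^q)`, where `ι : L → L'`. -/
def substX {L L' : Type u} [Field L] [Field L'] (ι : L →+* L') (μ : L') (q : ℕ) (hq : q ≠ 0) :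
    PowerSeries L →+* PowerSeries L' :=
  ((PowerSeries.expand q hq : PowerSeries L' →ₐ[L'] PowerSeries L').toRingHom.comp
    (PowerSeries.rescale μ)).comp (PowerSeries.map ι)

/-- The ring homomorphism `L[[x]][y] → L'[[x]][y]`, `G(x, y) ↦ G(μ x^q, Y)`,
where `ι : L → L'` and `Y ∈ L'[[x]][y]`. -/
def substXY {L L' : Type u} [Field L] [Field L'] (ι : L →+* L') (μ : L') (q : ℕ) (hq : q ≠ 0)
    (Y : Polynomial (PowerSeries L')) :
    Polynomial (PowerSeries L) →+* Polynomial (PowerSeries L') :=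
  Polynomial.eval₂RingHom (Polynomial.C.comp (substX ι μ q hq)) Y

open Classical in
/-- The Weierstrass polynomial `G` with `A = x^n G V` for a unit `V` of `L[[x, y]]`
(which is `L[[x]][[y]]`); `0` if there is none. -/
def weierstrassFactor {L : Type u} [Field L] (n : ℕ) (A : Polynomial (PowerSeries L)) :
    Polynomial (PowerSeries L) :=
  if h : ∃ G : Polynomial (PowerSeries L), IsWeierstrass G ∧
      ∃ V : PowerSeries (PowerSeries L), IsUnit V ∧
        (A : PowerSeries (PowerSeries L)) =
          PowerSeries.C ((PowerSeries.X : PowerSeries L) ^ n) *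
            (G : PowerSeries (PowerSeries L)) * V
  then h.choose else 0

/-- What the algorithm knows at rank `k`: the residue field `L = K_k`, the pull-back
`π_k^* : K[[x]][y] → K_k[[x]][y]` and the transform `H = H_k`. -/
structure Stage (K : Type u) [Field K] where
  L : Type u
  [field : Field L]
  pull : Polynomial (PowerSeries K) →+* Polynomial (PowerSeries L)
  H : Polynomial (PowerSeries L)

attribute [instance] Stage.field

/-- Rank `0`: `π_0(x, y) = (x, y + c_0(x))` and `H_0 = F(x, y + c_0(x))`. -/
def Stage.init {K : Type u} [Field K] (F : Polynomial (PowerSeries K)) : Stage K where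
  L := K
  pull := Polynomial.compRingHom (Polynomial.X + Polynomial.C (shift F))
  H := F.comp (Polynomial.X + Polynomial.C (shift F))

namespace EdgeData

variable {L : Type u} [Field L] {G : Polynomial (PowerSeries L)}

/-- The integer `t` of the Bézout relation `q s - t m = 1`, `0 ≤ t < q`. -/
def t (E : EdgeData G) : ℕ := sInf {t : ℕ | E.q ∣ t * E.m + 1}

/-- The integer `s` of the Bézout relation `q s - t m = 1`, `0 ≤ t < q`. -/
def s (E : EdgeData G) : ℕ := (E.t * E.m + 1) / E.q

/-- The field `L[Z] / (P(Z))`. -/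
abbrev ResidueField (E : EdgeData G) : Type u := AdjoinRoot E.P

instance (E : EdgeData G) : Fact (Irreducible E.P) := ⟨E.irreducible⟩

/-- The residue class `z` of `Z`. -/
def z (E : EdgeData G) : E.ResidueField := AdjoinRoot.root E.P

/-- The polynomial `x^m (y + z^s + c(x))`. -/
def yImage (E : EdgeData G) (c : PowerSeries E.ResidueField) :
    Polynomial (PowerSeries E.ResidueField) :=
  Polynomial.C (PowerSeries.X ^ E.m) *
    (Polynomial.X + Polynomial.C (PowerSeries.C (E.z ^ E.s) + c))

/-- The pull-back `A(x, y) ↦ A(z^t x^q, x^m (y + z^s + c(x)))`. -/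
def sigmaPull (E : EdgeData G) (c : PowerSeries E.ResidueField) :
    Polynomial (PowerSeries L) →+* Polynomial (PowerSeries E.ResidueField) :=
  substXY (AdjoinRoot.of E.P) (E.z ^ E.t) E.q E.q_pos.ne' (E.yImage c)

/-- The Weierstrass polynomial `G'` with
`G(z^t x^q, x^m (y + z^s)) = x^(q m ℓ N) G' V`, `V` a unit of `L'[[x, y]]`, `ℓ = deg P`. -/
def next (E : EdgeData G) : Polynomial (PowerSeries E.ResidueField) :=
  weierstrassFactor (E.q * E.m * E.P.natDegree * E.N) (E.sigmaPull 0 G)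

end EdgeData

/-- From rank `k` to rank `k + 1` with the edge data of `H_k`: one gets
`H_{k+1} = G_{k+1}(x, y + c_{k+1}(x))` and `π_{k+1} = π_k ∘ σ_{k+1}`. -/
def Stage.transform {K : Type u} [Field K] (S : Stage K) (E : EdgeData S.H) : Stage K where
  L := E.ResidueField
  pull := (E.sigmaPull (shift E.next)).comp S.pull
  H := E.next.comp (Polynomial.X + Polynomial.C (shift E.next))

open Classical in
/-- The next stage (the same stage, by convention, if `H` is not degenerated). -/
def Stage.succ {K : Type u} [Field K] (S : Stage K) : Stage K :=
  if h : Nonempty (EdgeData S.H) then S.transform h.some else S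

open Classical in
/-- The product `q ℓ`, `ℓ = deg P`, for the edge data `(q, m, P, N)` of `H`
(`1`, by convention, if `H` is not degenerated). -/
def Stage.qℓ {K : Type u} [Field K] (S : Stage K) : ℕ :=
  if h : Nonempty (EdgeData S.H) then h.some.q * h.some.P.natDegree else 1

/-- The sequence of stages of the algorithm applied to `F`. -/
def stage {K : Type u} [Field K] (F : Polynomial (PowerSeries K)) : ℕ → Stage K
  | 0 => Stage.init F
  | k + 1 => (stage F k).succ

/-- The `k`-th Newton–Puiseux transform `H_k` of `F`. -/
def transform {K : Type u} [Field K] (F : Polynomial (PowerSeries K)) (k : ℕ) :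
    Polynomial (PowerSeries (stage F k).L) :=
  (stage F k).H

/-- The algorithm stops at rank `i`: `N_i = 1` or `H_i` is not degenerated. -/
def StopsAt {K : Type u} [Field K] (F : Polynomial (PowerSeries K)) (i : ℕ) : Prop :=
  (transform F i).natDegree = 1 ∨ ¬ IsDegenerated (transform F i)

/-! ### Valuations and minimal polynomials -/

/-- The `x`-valuation of `∑ aᵢ(x) yⁱ`, i.e. `minᵢ val aᵢ`. -/
def xVal {L : Type u} [Field L] (G : Polynomial (PowerSeries L)) : ℕ∞ :=
  ⨅ i : ℕ, (G.coeff i).order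

/-- The valuation `v_k(G) = val(π_k^* G)`. -/
def v {K : Type u} [Field K] (F : Polynomial (PowerSeries K)) (k : ℕ)
    (G : Polynomial (PowerSeries K)) : ℕ∞ :=
  xVal ((stage F k).pull G)

/-- Evaluation at the truncated rational Puiseux parametrisation
`π_k(x, 0) = (μ_k x^{e_k}, S_k(x))`. -/
def evalParam {K : Type u} [Field K] (F : Polynomial (PowerSeries K)) (k : ℕ) :
    Polynomial (PowerSeries K) →+* PowerSeries (stage F k).L :=
  (Polynomial.evalRingHom 0).comp (stage F k).pull

/-- The `k`-th minimal polynomial `φ_k` of `F`: the minimal polynomial over `K[[x]]` of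
`S_k ∈ K_k[[x]]`, where `K[[x]]` acts on `K_k[[x]]` through `x ↦ μ_k x^{e_k}`. -/
def phi {K : Type u} [Field K] (F : Polynomial (PowerSeries K)) (k : ℕ) :
    Polynomial (PowerSeries K) :=
  @minpoly (PowerSeries K) (PowerSeries (stage F k).L) _ _
    ((evalParam F k).comp Polynomial.C).toAlgebra (evalParam F k Polynomial.X)

/-! ### The `Φ`-adic expansion

Exponents `B = (b_{-1}, b_0, …, b_k)` are functions on `Fin (k + 2)`: the value at `j` is
`b_{j-1}`. -/

/-- The family `Φ = (x, φ_0, …, φ_k)`. -/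
def Phi {K : Type u} [Field K] (F : Polynomial (PowerSeries K)) (k : ℕ) :
    Fin (k + 2) → Polynomial (PowerSeries K) :=
  Fin.cons (Polynomial.C PowerSeries.X) (fun i : Fin (k + 1) => phi F i)

/-- The set of exponents `B` with `b_{i-1} < q_i ℓ_i` for `i = 1, …, k`. -/
def exponents {K : Type u} [Field K] (F : Polynomial (PowerSeries K)) (k : ℕ) :
    Set (Fin (k + 2) → ℕ) :=
  {B | ∀ i : Fin k, B i.succ.castSucc < (stage F i).qℓ}

/-- `F = ∑_B f_B Φ^B`, the sum being over the exponents in `exponents F k`. Only finitely many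
tails `(b_0, …, b_k)` occur, and the terms with a given tail are collected in a power series
in `φ_{-1} = x`. -/
structure IsPhiAdicExpansion {K : Type u} [Field K] (F : Polynomial (PowerSeries K)) (k : ℕ)
    (f : (Fin (k + 2) → ℕ) → K) : Prop where
  support : ∀ B, f B ≠ 0 → B ∈ exponents F k
  finite : {b : Fin (k + 1) → ℕ | ∃ n : ℕ, f (Fin.cons n b) ≠ 0}.Finite
  sum_eq : F = ∑ᶠ b : Fin (k + 1) → ℕ,
    Polynomial.C (PowerSeries.mk fun n => f (Fin.cons n b)) *
      ∏ i : Fin (k + 1), Phi F k i.succ ^ b i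

/-- The scalar product `⟨B, V⟩` with `V = (v_k(φ_{-1}), …, v_k(φ_k))`. -/
def scalarV {K : Type u} [Field K] (F : Polynomial (PowerSeries K)) (k : ℕ)
    (B : Fin (k + 2) → ℕ) : ℕ∞ :=
  ∑ j : Fin (k + 2), (B j : ℕ∞) * v F k (Phi F k j)

/-- `w_i = min {⟨B, V⟩ | b_k = i, f_B ≠ 0} - v_k(F)`, and `∞` if the set is empty.
(The valuation `v_k(F)` of `F ≠ 0` is finite.) -/
def w {K : Type u} [Field K] (F : Polynomial (PowerSeries K)) (k : ℕ)
    (f : (Fin (k + 2) → ℕ) → K) (i : ℕ) : WithTop ℤ :=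
  ENat.map (fun n : ℕ => (n : ℤ) - ((v F k F).toNat : ℤ))
    (⨅ B ∈ {B : Fin (k + 2) → ℕ | B (Fin.last (k + 1)) = i ∧ f B ≠ 0}, scalarV F k B)

end

end NewtonPuiseux

/-!
The theorem rests on a description of the pull-backs `π_k^*` on the polynomials `φ_i`.

Call `A ∈ L[[x]][y]` *regular* if `A = x^n U` with `U(0, 0) ≠ 0`. By induction on `k`
(`StageInvariant`): `φ_k` is monic of degree `∏ q_i ℓ_i` (`i ≤ k`), every nonzero `G` of smaller
degree and every `φ_i` with `i < k` have a regular pull-back, `π_k^* φ_k = x^a y U` with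
`U(0, 0) ≠ 0`, and `π_k^* F = x^v H_k V` with `V(0, 0) ≠ 0`. Since `F` is square-free, `H_k` is not
a power of `y` unless its degree is at most `1` (otherwise `φ_k²` would divide `F`), so that
`m_{k+1} > 0` and `z_{k+1} ≠ 0` at the next stage.

The induction step is a computation of leading forms (`EdgeData.exists_sum_sigmaPull_eq`). For
`G = ∑ A_b φ_k^b` with `deg A_b < deg φ_k`, the terms of least valuation of `π_{k+1}^* G` contribute
at the origin elements `γ_b z^(e b)` with `γ_b ∈ K_k` nonzero; the Bézout relation `q s - t m = 1`
makes the exponents distinct and places them in a window of length `ℓ` when `b < q ℓ`. As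
`1, z, …, z^(ℓ - 1)` are linearly independent over `K_k`, nothing cancels: `π_{k+1}^* G` is regular
and its valuation is the least of those of the terms. This bounds the degree of `φ_{k+1}` from
below; the Cayley–Hamilton theorem (`IsSpannedBy.exists_monic`) bounds it from above. For
`G = φ_{k+1}` one more exponent occurs, and the sum, which must vanish, is a multiple of `P(z)`;
the derivative of the leading form at `y = 0` is then a nonzero multiple of `q P'(z)`, which is
nonzero because `q` and `ℓ` are at most `d`. This gives the shape of `π_{k+1}^* φ_{k+1}`.

In particular the valuation of a `Φ`-adic expansion without `φ_k` is the least of the numbers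
`⟨B, V⟩` (`StageInvariant.xVal_boxSum`), which gives the uniqueness of expansions, and
`π_k^* F = ∑ A_i φ_k^i` becomes `∑ x^(w_i + v) y^i U_i` with `U_i(0, 0) ≠ 0`. On the other hand
`π_k^* F = x^v H_k V` has the same form, with the orders of the coefficients of `H_k` as exponents.
The running minima of the exponents are those of the orders of the coefficients of `π_k^* F`
(`forall_le_order_iff`), hence are the same for both. As both sets of points contain `(N_k, 0)` and
lie above the horizontal axis, their lower convex hulls agree
(`lowerConvexHull_eq_of_forall_exists`).
-/

namespace NewtonPuiseux

noncomputable section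

open Polynomial (C)

/-! ### Reduction modulo `x`, value at the origin, and the `x`-valuation -/

section Valuation

variable {L : Type u} [Field L]

/-- The reduction modulo `x`, from `L[[x]][y]` to `L[y]`. -/
def reduction : Polynomial (PowerSeries L) →+* Polynomial L :=
  Polynomial.mapRingHom PowerSeries.constantCoeff

/-- The value `A(0, 0)` of `A ∈ L[[x]][y]` at the origin. -/
def originEval : Polynomial (PowerSeries L) →+* L :=
  (PowerSeries.constantCoeff).comp (Polynomial.evalRingHom 0)

/-- `A` is regular of value `n` if `A = x^n U` with `U(0, 0) ≠ 0`: the `x`-valuation of `A` is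
`n`, and it is attained by the constant coefficient of `A`. -/
def IsRegular (A : Polynomial (PowerSeries L)) (n : ℕ) : Prop :=
  ∃ U : Polynomial (PowerSeries L), A = C (PowerSeries.X ^ n) * U ∧ originEval U ≠ 0

@[simp] lemma coeff_reduction (A : Polynomial (PowerSeries L)) (i : ℕ) :
    (reduction A).coeff i = PowerSeries.constantCoeff (A.coeff i) := by
  simp [reduction]

@[simp] lemma reduction_C (a : PowerSeries L) :
    reduction (C a) = C (PowerSeries.constantCoeff a) := by
  simp [reduction]

@[simp] lemma reduction_X : reduction (Polynomial.X : Polynomial (PowerSeries L)) =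
    Polynomial.X := by
  simp [reduction]

lemma originEval_apply (A : Polynomial (PowerSeries L)) :
    originEval A = PowerSeries.constantCoeff (A.coeff 0) := by
  simp [originEval, Polynomial.coeff_zero_eq_eval_zero]

@[simp] lemma originEval_C (a : PowerSeries L) :
    originEval (C a) = PowerSeries.constantCoeff a := by
  simp [originEval]

@[simp] lemma originEval_X : originEval (Polynomial.X : Polynomial (PowerSeries L)) = 0 := by
  simp [originEval]

lemma originEval_eq_eval (A : Polynomial (PowerSeries L)) :
    originEval A = (reduction A).eval 0 := by
  rw [originEval_apply, ← Polynomial.coeff_zero_eq_eval_zero, coeff_reduction]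

lemma reduction_ne_zero_of_originEval {A : Polynomial (PowerSeries L)} (h : originEval A ≠ 0) :
    reduction A ≠ 0 := by
  rintro h0
  rw [originEval_eq_eval, h0] at h
  simp at h

lemma IsWeierstrass.reduction_eq {G : Polynomial (PowerSeries L)} (h : IsWeierstrass G) :
    reduction G = Polynomial.X ^ G.natDegree := by
  ext i
  rw [coeff_reduction, Polynomial.coeff_X_pow]
  split_ifs with hi
  · subst hi
    rw [Polynomial.coeff_natDegree, h.1.leadingCoeff, map_one]
  · rcases lt_or_gt_of_ne hi with hi | hi
    · exact h.2 i hi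
    · rw [Polynomial.coeff_eq_zero_of_natDegree_lt hi, map_zero]

lemma isWeierstrass_of_reduction_eq {G : Polynomial (PowerSeries L)} (hG : G.Monic)
    (h : reduction G = Polynomial.X ^ G.natDegree) : IsWeierstrass G := by
  refine ⟨hG, fun i hi => ?_⟩
  rw [← coeff_reduction, h, Polynomial.coeff_X_pow, if_neg hi.ne]

lemma xVal_le (A : Polynomial (PowerSeries L)) (i : ℕ) : xVal A ≤ (A.coeff i).order :=
  iInf_le _ i

@[simp] lemma xVal_zero : xVal (0 : Polynomial (PowerSeries L)) = ⊤ := by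
  simp [xVal]

lemma xVal_C (a : PowerSeries L) : xVal (C a) = a.order := by
  apply le_antisymm
  · simpa using xVal_le (C a) 0
  · refine le_iInf fun i => ?_
    rw [Polynomial.coeff_C]
    split_ifs <;> simp

lemma xVal_X_pow_mul (n : ℕ) {U : Polynomial (PowerSeries L)} (hU : reduction U ≠ 0) :
    xVal (C (PowerSeries.X ^ n) * U) = n := by
  apply le_antisymm
  · obtain ⟨i, hi⟩ := Polynomial.ext_iff.not.trans not_forall |>.1 hU
    refine (xVal_le _ i).trans ?_
    rw [coeff_reduction, Polynomial.coeff_zero] at hi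
    rw [Polynomial.coeff_C_mul]
    apply PowerSeries.order_le
    rw [PowerSeries.coeff_X_pow_mul', if_pos le_rfl]
    simpa using hi
  · refine le_iInf fun i => ?_
    rw [Polynomial.coeff_C_mul, PowerSeries.order_mul, PowerSeries.order_X_pow]
    exact le_self_add

lemma IsRegular.xVal_eq {A : Polynomial (PowerSeries L)} {n : ℕ} (h : IsRegular A n) :
    xVal A = n := by
  obtain ⟨U, rfl, hU⟩ := h
  exact xVal_X_pow_mul n (reduction_ne_zero_of_originEval hU)

lemma IsRegular.coeff_zero_ne {A : Polynomial (PowerSeries L)} {n : ℕ} (h : IsRegular A n) :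
    A.coeff 0 ≠ 0 := by
  obtain ⟨U, rfl, hU⟩ := h
  rw [Polynomial.coeff_C_mul]
  refine mul_ne_zero (pow_ne_zero _ PowerSeries.X_ne_zero) fun h => hU ?_
  rw [originEval_apply, h, map_zero]

lemma exists_eq_X_pow_mul {a : PowerSeries L} (ha : a ≠ 0) :
    ∃ n : ℕ, a.order = n ∧ ∃ b : PowerSeries L, a = PowerSeries.X ^ n * b ∧
      PowerSeries.constantCoeff b ≠ 0 :=
  ⟨a.order.toNat, (PowerSeries.coe_toNat_order ha).symm, a.divXPowOrder,
    PowerSeries.X_pow_order_mul_divXPowOrder.symm, by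
      rwa [Ne, PowerSeries.constantCoeff_divXPowOrder_eq_zero_iff]⟩

lemma isRegular_C {a : PowerSeries L} (ha : a ≠ 0) : ∃ n, IsRegular (C a) n := by
  obtain ⟨n, -, b, hb, hb0⟩ := exists_eq_X_pow_mul ha
  exact ⟨n, C b, by rw [hb, ← Polynomial.C_mul], by simpa using hb0⟩

/-- If `A = ∑ x^(u j) y^j U_j` with `U_j(0, 0) ≠ 0`, then the running minima of the exponents
`u j` are those of the orders of the coefficients of `A`. -/
lemma forall_le_order_iff (T : Finset ℕ) (w : ℕ → ℕ) (U : ℕ → Polynomial (PowerSeries L))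
    (hU : ∀ j ∈ T, originEval (U j) ≠ 0) (i t : ℕ) :
    (∀ j ≤ i, (t : ℕ∞) ≤ ((∑ j ∈ T, C (PowerSeries.X ^ w j) *
      (Polynomial.X ^ j * U j)).coeff j).order) ↔ ∀ j ∈ T, j ≤ i → t ≤ w j := by
  have hcoeff : ∀ l, (∑ j ∈ T, C (PowerSeries.X ^ w j) * (Polynomial.X ^ j * U j)).coeff l =
      ∑ j ∈ T, if j ≤ l then PowerSeries.X ^ w j * (U j).coeff (l - j) else 0 := by
    intro l
    rw [Polynomial.finsetSum_coeff]
    refine Finset.sum_congr rfl fun j _ => ?_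
    rw [Polynomial.coeff_C_mul, Polynomial.coeff_X_pow_mul']
    split_ifs <;> simp
  constructor
  · intro h
    by_contra hcon
    -- the first exponent below `t` cannot be compensated by the earlier terms
    have hex : ∃ j, j ∈ T ∧ j ≤ i ∧ w j < t := by
      push Not at hcon
      exact hcon
    classical
    obtain ⟨hjT, hji, hjt⟩ := Nat.find_spec hex
    set j := Nat.find hex with hj
    have hmin : ∀ l ∈ T, l < j → t ≤ w l := by
      intro l hl hlj
      by_contra hc
      exact Nat.find_min hex hlj ⟨hl, hlj.le.trans hji, not_le.1 hc⟩
    have h1 := PowerSeries.coeff_of_lt_order (w j) (lt_of_lt_of_le (by exact_mod_cast hjt) (h j hji))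
    rw [hcoeff, map_sum, Finset.sum_eq_single j] at h1
    · rw [if_pos le_rfl, PowerSeries.coeff_X_pow_mul', if_pos le_rfl, Nat.sub_self, Nat.sub_self,
        PowerSeries.coeff_zero_eq_constantCoeff, ← originEval_apply] at h1
      exact hU j hjT h1
    · intro l hl hlj
      split_ifs with hle
      · have := hmin l hl (lt_of_le_of_ne hle hlj)
        rw [PowerSeries.coeff_X_pow_mul', if_neg (by omega)]
      · simp
    · exact fun h => absurd hjT h
  · intro h l hl
    rw [hcoeff]
    apply PowerSeries.le_order
    intro n hn
    have hn : n < t := by exact_mod_cast hn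
    rw [map_sum]
    refine Finset.sum_eq_zero fun j hj => ?_
    split_ifs with hle
    · have := h j hj (hle.trans hl)
      rw [PowerSeries.coeff_X_pow_mul', if_neg (by omega)]
    · simp

end Valuation

/-! ### Sums of powers of the residue class `z` -/

section AdjoinRoot

variable {L : Type u} [Field L] {P : Polynomial L} (γ : ℕ → L) (e : ℕ → ℕ) {M : Finset ℕ}
  {q κ ℓ : ℕ}

/-- If the exponents satisfy `q e(b) = κ + b`, then `∑ γ_b z^(e b)` is `z^(e₀) p(z)` for a
polynomial `p` whose degree is controlled by the size of the indices `b`, and the weighted sum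
`∑ b γ_b z^(e b)` is the corresponding expression in the derivative of `p`. -/
lemma exists_polynomial_of_sum_root_pow (hq : 0 < q) (hM : M.Nonempty) (hγ : ∀ b ∈ M, γ b ≠ 0)
    (he : ∀ b ∈ M, q * e b = κ + b) :
    ∃ (b₀ e₀ : ℕ) (p : Polynomial L), p ≠ 0 ∧
      (∀ n, (∀ b ∈ M, b < q * (n + 1)) → p.natDegree ≤ n) ∧
      ∑ b ∈ M, AdjoinRoot.of P (γ b) * AdjoinRoot.root P ^ e b =
        AdjoinRoot.root P ^ e₀ * AdjoinRoot.mk P p ∧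
      ∑ b ∈ M, (b : AdjoinRoot P) * (AdjoinRoot.of P (γ b) * AdjoinRoot.root P ^ e b) =
        b₀ * (AdjoinRoot.root P ^ e₀ * AdjoinRoot.mk P p) +
        q * (AdjoinRoot.root P ^ (e₀ + 1) * AdjoinRoot.mk P (Polynomial.derivative p)) := by
  obtain ⟨b₀, hb₀, hbase⟩ : ∃ b₀ ∈ M, ∀ b ∈ M, e b₀ ≤ e b ∧ b = b₀ + q * (e b - e b₀) := by
    refine ⟨M.min' hM, M.min'_mem hM, fun b hb => ?_⟩
    have h1 := he b hb
    have h2 := he _ (M.min'_mem hM)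
    have h3 := M.min'_le b hb
    have h4 : e (M.min' hM) ≤ e b := by
      by_contra hc
      have : q * e b < q * e (M.min' hM) := Nat.mul_lt_mul_of_pos_left (not_le.1 hc) hq
      omega
    refine ⟨h4, ?_⟩
    rw [Nat.mul_sub]
    have := Nat.mul_le_mul_left q h4
    omega
  set p : Polynomial L := ∑ b ∈ M, Polynomial.monomial (e b - e b₀) (γ b) with hp
  have hsum : ∑ b ∈ M, AdjoinRoot.of P (γ b) * AdjoinRoot.root P ^ e b =
      AdjoinRoot.root P ^ e b₀ * AdjoinRoot.mk P p := by
    rw [hp, map_sum, Finset.mul_sum]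
    refine Finset.sum_congr rfl fun b hb => ?_
    rw [← Polynomial.C_mul_X_pow_eq_monomial, map_mul, map_pow, AdjoinRoot.mk_C, AdjoinRoot.mk_X,
      mul_left_comm, ← pow_add, Nat.add_sub_cancel' (hbase b hb).1]
  refine ⟨b₀, e b₀, p, ?_, ?_, hsum, ?_⟩
  · intro hp0
    have hcoeff : p.coeff 0 = γ b₀ := by
      rw [hp, Polynomial.finsetSum_coeff, Finset.sum_eq_single b₀]
      · simp
      · intro b hbM hne
        rw [Polynomial.coeff_monomial, if_neg]
        intro h0
        have := (hbase b hbM).2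
        rw [h0] at this
        exact hne (by simpa using this)
      · exact fun h => absurd hb₀ h
    rw [hp0, Polynomial.coeff_zero] at hcoeff
    exact hγ b₀ hb₀ hcoeff.symm
  · intro n hn
    refine Polynomial.natDegree_sum_le_of_forall_le _ _ fun b hb => ?_
    refine (Polynomial.natDegree_monomial_le _).trans ?_
    have h1 := (hbase b hb).2
    have h2 := hn b hb
    have : q * (e b - e b₀) < q * (n + 1) := by omega
    exact Nat.lt_succ_iff.1 (Nat.lt_of_mul_lt_mul_left this)
  · have hX : AdjoinRoot.root P * AdjoinRoot.mk P (Polynomial.derivative p) =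
        ∑ b ∈ M, ((e b - e b₀ : ℕ) : AdjoinRoot P) *
          (AdjoinRoot.of P (γ b) * AdjoinRoot.root P ^ (e b - e b₀)) := by
      rw [hp, Polynomial.derivative_sum, map_sum, Finset.mul_sum]
      refine Finset.sum_congr rfl fun b hb => ?_
      rw [Polynomial.derivative_monomial, ← Polynomial.C_mul_X_pow_eq_monomial, map_mul, map_pow,
        AdjoinRoot.mk_C, AdjoinRoot.mk_X, map_mul, map_natCast]
      rcases Nat.eq_zero_or_pos (e b - e b₀) with h | h
      · simp [h]
      · obtain ⟨j, hj⟩ := Nat.exists_eq_succ_of_ne_zero h.ne'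
        rw [hj, Nat.succ_sub_one, pow_succ]
        ring
    rw [← hsum, pow_succ, mul_assoc, hX, Finset.mul_sum, Finset.mul_sum, Finset.mul_sum,
      ← Finset.sum_add_distrib]
    refine Finset.sum_congr rfl fun b hb => ?_
    obtain ⟨h1, h2⟩ := hbase b hb
    have h3 : (b : AdjoinRoot P) = b₀ + q * (e b - e b₀ : ℕ) := by
      conv_lhs => rw [h2]
      push_cast
      ring
    have h4 : AdjoinRoot.root P ^ e b =
        AdjoinRoot.root P ^ e b₀ * AdjoinRoot.root P ^ (e b - e b₀) := by
      rw [← pow_add, Nat.add_sub_cancel' h1]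
    rw [h3, h4]
    ring

variable [Fact (Irreducible P)]

/-- With indices below `q ℓ` the exponents lie in a window of length `ℓ = deg P`, so that the
powers of `z` that occur are linearly independent. -/
lemma sum_root_pow_ne_zero (hq : 0 < q) (hP : P.natDegree = ℓ) (hz : AdjoinRoot.root P ≠ 0)
    (hM : M.Nonempty) (hγ : ∀ b ∈ M, γ b ≠ 0) (he : ∀ b ∈ M, q * e b = κ + b)
    (hb : ∀ b ∈ M, b < q * ℓ) :
    ∑ b ∈ M, AdjoinRoot.of P (γ b) * AdjoinRoot.root P ^ e b ≠ 0 := by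
  obtain ⟨b₀, e₀, p, hp0, hdeg, hsum, -⟩ :=
    exists_polynomial_of_sum_root_pow (P := P) γ e hq hM hγ he
  rw [hsum]
  refine mul_ne_zero (pow_ne_zero _ hz) fun h => hp0 ?_
  rw [AdjoinRoot.mk_eq_zero] at h
  have hℓ : 0 < ℓ := (Fact.out : Irreducible P).natDegree_pos.trans_eq hP
  refine Polynomial.eq_zero_of_dvd_of_natDegree_lt h ?_
  have := hdeg (ℓ - 1) (by rwa [Nat.sub_add_cancel hℓ])
  omega

/-- With one more exponent than in `sum_root_pow_ne_zero` the sum may vanish; it is then a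
multiple of `P(z)`, and the weighted sum is a nonzero multiple of `P'(z)`. -/
lemma sum_mul_root_pow_ne_zero (hq : 0 < q) (hP : P.natDegree = ℓ)
    (hz : AdjoinRoot.root P ≠ 0) (hM : M.Nonempty) (hγ : ∀ b ∈ M, γ b ≠ 0)
    (he : ∀ b ∈ M, q * e b = κ + b) (hb : ∀ b ∈ M, b ≤ q * ℓ)
    (hqL : (q : L) ≠ 0) (hℓL : (ℓ : L) ≠ 0)
    (h0 : ∑ b ∈ M, AdjoinRoot.of P (γ b) * AdjoinRoot.root P ^ e b = 0) :
    ∑ b ∈ M, (b : AdjoinRoot P) * (AdjoinRoot.of P (γ b) * AdjoinRoot.root P ^ e b) ≠ 0 := by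
  obtain ⟨b₀, e₀, p, hp0, hdeg, hsum, hsum'⟩ :=
    exists_polynomial_of_sum_root_pow (P := P) γ e hq hM hγ he
  rw [hsum', ← hsum, h0, mul_zero, zero_add]
  have hℓ : 0 < ℓ := (Fact.out : Irreducible P).natDegree_pos.trans_eq hP
  have hqA : (q : AdjoinRoot P) ≠ 0 := by
    rw [← map_natCast (AdjoinRoot.of P)]
    exact (map_ne_zero _).2 hqL
  refine mul_ne_zero hqA (mul_ne_zero (pow_ne_zero _ hz) fun h => ?_)
  rw [AdjoinRoot.mk_eq_zero] at h
  have hdvd : P ∣ p := by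
    rw [← AdjoinRoot.mk_eq_zero]
    exact (mul_eq_zero.1 (hsum ▸ h0)).resolve_left (pow_ne_zero _ hz)
  have hdeg' : p.natDegree = ℓ := by
    refine le_antisymm (hdeg ℓ fun b hbM => (hb b hbM).trans_lt ?_)
      (hP ▸ Polynomial.natDegree_le_of_dvd hdvd hp0)
    exact Nat.mul_lt_mul_of_pos_left (Nat.lt_succ_self ℓ) hq
  have hd0 : Polynomial.derivative p = 0 := by
    refine Polynomial.eq_zero_of_dvd_of_natDegree_lt h ?_
    rw [hP, ← hdeg']
    exact Polynomial.natDegree_derivative_lt (by omega)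
  have hc : (Polynomial.derivative p).coeff (ℓ - 1) = p.leadingCoeff * ℓ := by
    rw [Polynomial.coeff_derivative, Polynomial.leadingCoeff, hdeg', Nat.sub_add_cancel hℓ,
      ← Nat.cast_add_one, Nat.sub_add_cancel hℓ]
  rw [hd0, Polynomial.coeff_zero] at hc
  exact mul_ne_zero (Polynomial.leadingCoeff_ne_zero.2 hp0) hℓL hc.symm

end AdjoinRoot

/-! ### The substitutions of the algorithm -/

section SubstX

variable {L L' : Type u} [Field L] [Field L'] (ι : L →+* L') (μ : L') (q : ℕ) (hq : q ≠ 0)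

lemma coeff_substX_mul (a : PowerSeries L) (n : ℕ) :
    PowerSeries.coeff (q * n) (substX ι μ q hq a) = μ ^ n * ι (PowerSeries.coeff n a) := by
  simp [substX, PowerSeries.coeff_expand_mul]

@[simp] lemma constantCoeff_substX (a : PowerSeries L) :
    PowerSeries.constantCoeff (substX ι μ q hq a) = ι (PowerSeries.constantCoeff a) := by
  simpa using coeff_substX_mul ι μ q hq a 0

lemma substX_X_pow (n : ℕ) : substX ι μ q hq (PowerSeries.X ^ n) =
    PowerSeries.X ^ (q * n) * PowerSeries.C (μ ^ n) := by
  have : substX ι μ q hq PowerSeries.X = PowerSeries.X ^ q * PowerSeries.C μ := by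
    simp only [substX, RingHom.comp_apply, PowerSeries.map_X, PowerSeries.rescale_X]
    simp [PowerSeries.expand_C, PowerSeries.expand_X, mul_comm]
  rw [map_pow, this, mul_pow, ← pow_mul, map_pow]

lemma order_substX (hμ : μ ≠ 0) (a : PowerSeries L) :
    (substX ι μ q hq a).order = q * a.order := by
  rcases eq_or_ne a 0 with rfl | ha
  · simp [hq]
  · obtain ⟨n, hn, b, rfl, hb⟩ := exists_eq_X_pow_mul ha
    have hb' : (substX ι μ q hq b).order = 0 := by
      apply PowerSeries.order_zero_of_unit
      rw [PowerSeries.isUnit_iff_constantCoeff, constantCoeff_substX, isUnit_iff_ne_zero]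
      exact (map_ne_zero ι).2 hb
    have hC : (PowerSeries.C (μ ^ n)).order = 0 :=
      PowerSeries.order_zero_of_unit ((isUnit_iff_ne_zero.2 (pow_ne_zero _ hμ)).map _)
    rw [hn, map_mul, substX_X_pow, PowerSeries.order_mul, PowerSeries.order_mul, hb', hC,
      PowerSeries.order_X_pow, add_zero, add_zero]
    push_cast
    rfl

end SubstX

section Comp

variable {L : Type u} [Field L] {c : PowerSeries L}

lemma originEval_comp_X_add_C (hc : PowerSeries.constantCoeff c = 0)
    (A : Polynomial (PowerSeries L)) :
    originEval (A.comp (Polynomial.X + C c)) = originEval A := by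
  suffices h : (originEval (L := L)).comp (Polynomial.compRingHom (Polynomial.X + C c)) =
      originEval from congrArg (fun f => f A) h
  refine Polynomial.ringHom_ext (fun a => ?_) ?_ <;> simp [hc]

lemma IsWeierstrass.constantCoeff_shift {G : Polynomial (PowerSeries L)} (hG : IsWeierstrass G) :
    PowerSeries.constantCoeff (shift G) = 0 := by
  rw [shift, map_mul, PowerSeries.constantCoeff_C]
  rcases Nat.eq_zero_or_pos G.natDegree with h | h
  · simp [h]
  · rw [hG.2 _ (Nat.sub_lt h one_pos), mul_zero]

lemma IsWeierstrass.comp {G : Polynomial (PowerSeries L)} (hG : IsWeierstrass G)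
    (hc : PowerSeries.constantCoeff c = 0) :
    IsWeierstrass (G.comp (Polynomial.X + C c)) := by
  refine isWeierstrass_of_reduction_eq (hG.1.comp_X_add_C c) ?_
  rw [Polynomial.natDegree_comp, Polynomial.natDegree_X_add_C, mul_one, ← hG.reduction_eq]
  simp only [reduction, Polynomial.coe_mapRingHom]
  rw [Polynomial.map_comp]
  simp [hc]

end Comp

namespace EdgeData

variable {L : Type u} [Field L] {G : Polynomial (PowerSeries L)} (E : EdgeData G)
  (c : PowerSeries E.ResidueField)

lemma bezout : E.q * E.s = E.t * E.m + 1 := by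
  have h : E.q ∣ E.t * E.m + 1 := by
    refine Nat.sInf_mem (s := {t : ℕ | E.q ∣ t * E.m + 1}) ?_
    obtain ⟨t, ht⟩ := Nat.exists_mul_mod_eq_of_coprime (E.q - 1) E.coprime.symm E.q_pos.ne'
    refine ⟨t, ?_⟩
    have h1 : E.m * t ≡ E.q - 1 [MOD E.q] := ht.2
    have h2 := h1.add_right 1
    rw [Nat.sub_add_cancel E.q_pos] at h2
    rw [Set.mem_ofPred_eq, mul_comm]
    exact (Nat.modEq_zero_iff_dvd.1 (h2.trans (by simp [Nat.ModEq])))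
  rw [s, Nat.mul_div_cancel' h]

@[simp] lemma sigmaPull_C (a : PowerSeries L) : E.sigmaPull c (C a) =
    C (substX (AdjoinRoot.of E.P) (E.z ^ E.t) E.q E.q_pos.ne' a) := by
  simp [sigmaPull, substXY]

@[simp] lemma sigmaPull_X : E.sigmaPull c Polynomial.X = E.yImage c := by
  simp [sigmaPull, substXY]

lemma sigmaPull_C_X_pow (n : ℕ) : E.sigmaPull c (C (PowerSeries.X ^ n)) =
    C (PowerSeries.X ^ (E.q * n)) * C (PowerSeries.C (E.z ^ (E.t * n))) := by
  rw [sigmaPull_C, substX_X_pow, Polynomial.C_mul, ← pow_mul]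

lemma reduction_sigmaPull (hm : E.m ≠ 0) (A : Polynomial (PowerSeries L)) :
    reduction (E.sigmaPull c A) = C (AdjoinRoot.of E.P (originEval A)) := by
  suffices h : reduction.comp (E.sigmaPull c) =
      (C.comp (AdjoinRoot.of E.P)).comp originEval from congrArg (fun f => f A) h
  refine Polynomial.ringHom_ext (fun a => ?_) ?_
  · simp
  · simp [yImage, hm]

lemma originEval_sigmaPull (hm : E.m ≠ 0) (A : Polynomial (PowerSeries L)) :
    originEval (E.sigmaPull c A) = AdjoinRoot.of E.P (originEval A) := by
  rw [originEval_eq_eval, E.reduction_sigmaPull c hm, Polynomial.eval_C]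

/-- Shifting `y` after the substitution amounts to changing the shift in the substitution. -/
lemma comp_sigmaPull_zero (A : Polynomial (PowerSeries L)) :
    (E.sigmaPull 0 A).comp (Polynomial.X + C c) = E.sigmaPull c A := by
  suffices h : (Polynomial.compRingHom (Polynomial.X + C c)).comp (E.sigmaPull 0) =
      E.sigmaPull c from congrArg (fun f => f A) h
  refine Polynomial.ringHom_ext (fun a => ?_) ?_
  · simp
  · simp [yImage]
    ring

variable {c}

lemma isRegular_sigmaPull (hm : E.m ≠ 0) (hz : E.z ≠ 0) {A : Polynomial (PowerSeries L)} {n : ℕ}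
    (hA : IsRegular A n) : IsRegular (E.sigmaPull c A) (E.q * n) := by
  obtain ⟨U, rfl, hU⟩ := hA
  refine ⟨C (PowerSeries.C (E.z ^ (E.t * n))) * E.sigmaPull c U, ?_, ?_⟩
  · rw [map_mul, sigmaPull_C_X_pow, mul_assoc]
  · rw [map_mul, originEval_C, PowerSeries.constantCoeff_C, E.originEval_sigmaPull c hm]
    exact mul_ne_zero (pow_ne_zero _ hz) ((map_ne_zero _).2 hU)

/-- The image of `x^a y U`. -/
lemma sigmaPull_X_pow_mul_X_mul (a : ℕ) (U : Polynomial (PowerSeries L)) :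
    E.sigmaPull c (C (PowerSeries.X ^ a) * (Polynomial.X * U)) =
      C (PowerSeries.X ^ (E.q * a + E.m)) * (C (PowerSeries.C (E.z ^ (E.t * a))) *
        (Polynomial.X + C (PowerSeries.C (E.z ^ E.s) + c)) * E.sigmaPull c U) := by
  rw [map_mul, map_mul, sigmaPull_C_X_pow, sigmaPull_X, yImage, pow_add, Polynomial.C_mul]
  ring

lemma isRegular_sigmaPull_X_mul (hm : E.m ≠ 0) (hz : E.z ≠ 0)
    (hc : PowerSeries.constantCoeff c = 0) (a : ℕ)
    {U : Polynomial (PowerSeries L)} (hU : originEval U ≠ 0) :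
    IsRegular (E.sigmaPull c (C (PowerSeries.X ^ a) * (Polynomial.X * U))) (E.q * a + E.m) := by
  refine ⟨_, E.sigmaPull_X_pow_mul_X_mul a U, ?_⟩
  simp only [map_mul, map_add, originEval_C, originEval_X, PowerSeries.constantCoeff_C, hc,
    E.originEval_sigmaPull c hm, zero_add, add_zero]
  exact mul_ne_zero (mul_ne_zero (pow_ne_zero _ hz) (pow_ne_zero _ hz)) ((map_ne_zero _).2 hU)

end EdgeData

/-! ### The leading form of a sum of substituted terms -/

namespace EdgeData

variable {L : Type u} [Field L] {G : Polynomial (PowerSeries L)} (E : EdgeData G)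
  {c : PowerSeries E.ResidueField}

/-- Let `A_b` be regular of value `n b` and `Y = x^a y U` with `U(0, 0) ≠ 0`. The leading form in
`x` of `∑ σ(A_b) σ(Y)^b` at `y = 0` is a sum of terms `γ_b z^(e b)` over the indices `b` at which
the value `q n(b) + b (q a + m)` is the least value `w`. The Bézout relation gives
`q e(b) = t w + b`, so that distinct indices have distinct exponents and the terms cannot cancel
as long as `b < q ℓ`. -/
lemma exists_sum_sigmaPull_eq (hm : E.m ≠ 0) (hz : E.z ≠ 0)
    (hc : PowerSeries.constantCoeff c = 0) {T : Finset ℕ} (hT : T.Nonempty) {n : ℕ → ℕ}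
    {A : ℕ → Polynomial (PowerSeries L)} (hA : ∀ b ∈ T, IsRegular (A b) (n b)) (a : ℕ)
    {U : Polynomial (PowerSeries L)} (hU : originEval U ≠ 0)
    (hb : ∀ b ∈ T, b ≤ E.q * E.P.natDegree) :
    ∃ (w : ℕ) (B : Polynomial (PowerSeries E.ResidueField)),
      (∀ b ∈ T, w ≤ E.q * n b + b * (E.q * a + E.m)) ∧
      (∃ b ∈ T, E.q * n b + b * (E.q * a + E.m) = w) ∧
      ∑ b ∈ T, E.sigmaPull c (A b) *
        E.sigmaPull c (C (PowerSeries.X ^ a) * (Polynomial.X * U)) ^ b =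
        C (PowerSeries.X ^ w) * B ∧
      ((∀ b ∈ T, b < E.q * E.P.natDegree) → originEval B ≠ 0) ∧
      ((E.q : L) ≠ 0 → (E.P.natDegree : L) ≠ 0 → originEval B = 0 →
        (Polynomial.derivative (reduction B)).eval 0 ≠ 0) := by
  choose! V hV hV0 using hA
  obtain ⟨b₁, hb₁, hmin⟩ := T.exists_min_image (fun b => E.q * n b + b * (E.q * a + E.m)) hT
  set w := E.q * n b₁ + b₁ * (E.q * a + E.m) with hw
  -- the term of index `b`, divided by its power of `x`
  set D : ℕ → Polynomial (PowerSeries E.ResidueField) := fun b =>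
    C (PowerSeries.C (E.z ^ (E.t * n b))) * E.sigmaPull c (V b) *
      (C (PowerSeries.C (E.z ^ (E.t * a))) *
        (Polynomial.X + C (PowerSeries.C (E.z ^ E.s) + c)) * E.sigmaPull c U) ^ b with hD
  have hterm : ∀ b ∈ T, E.sigmaPull c (A b) *
      E.sigmaPull c (C (PowerSeries.X ^ a) * (Polynomial.X * U)) ^ b =
      C (PowerSeries.X ^ (E.q * n b + b * (E.q * a + E.m))) * D b := by
    intro b hb
    rw [hV b hb, map_mul, sigmaPull_C_X_pow, sigmaPull_X_pow_mul_X_mul, hD]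
    simp only [pow_add, pow_mul, mul_pow, Polynomial.C_mul, Polynomial.C_pow]
    ring
  set γ : ℕ → L := fun b => originEval (V b) * originEval U ^ b with hγ
  set e : ℕ → ℕ := fun b => E.t * (n b + a * b) + E.s * b with he
  have hred : ∀ b, reduction (D b) = C (AdjoinRoot.of E.P (γ b) *
      E.z ^ (E.t * (n b + a * b))) * (Polynomial.X + C (E.z ^ E.s)) ^ b := by
    intro b
    rw [hD]
    simp only [map_mul, map_pow, map_add, reduction_C, reduction_X, PowerSeries.constantCoeff_C,
      hc, E.reduction_sigmaPull c hm, Polynomial.C_0, add_zero, hγ, mul_pow]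
    rw [mul_add E.t, pow_add, ← mul_assoc E.t, pow_mul _ _ b]
    ring
  have hredsum : reduction (∑ b ∈ T, C (PowerSeries.X ^ (E.q * n b + b * (E.q * a + E.m) - w)) *
      D b) = ∑ b ∈ T with E.q * n b + b * (E.q * a + E.m) = w, reduction (D b) := by
    rw [map_sum, Finset.sum_filter]
    refine Finset.sum_congr rfl fun b hb => ?_
    rw [map_mul, reduction_C]
    split_ifs with h
    · simp [h]
    · have h1 := hmin b hb
      have : E.q * n b + b * (E.q * a + E.m) - w ≠ 0 := by omega
      simp [this]
  set M := T.filter (fun b => E.q * n b + b * (E.q * a + E.m) = w) with hM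
  have hMne : M.Nonempty := ⟨b₁, by simp [hM, hb₁, hw]⟩
  have hγ0 : ∀ b ∈ M, γ b ≠ 0 := fun b hb =>
    mul_ne_zero (hV0 b (Finset.mem_filter.1 hb).1) (pow_ne_zero _ hU)
  have hexp : ∀ b ∈ M, E.q * e b = E.t * w + b := by
    intro b hb
    rw [← (Finset.mem_filter.1 hb).2, he]
    simp only [mul_add, ← mul_assoc, E.bezout]
    ring
  have hval : originEval (∑ b ∈ T,
      C (PowerSeries.X ^ (E.q * n b + b * (E.q * a + E.m) - w)) * D b) =
      ∑ b ∈ M, AdjoinRoot.of E.P (γ b) * E.z ^ e b := by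
    rw [originEval_eq_eval, hredsum, Polynomial.eval_finsetSum]
    refine Finset.sum_congr rfl fun b _ => ?_
    rw [hred, he]
    simp only [Polynomial.eval_mul, Polynomial.eval_C, Polynomial.eval_pow, Polynomial.eval_add,
      Polynomial.eval_X, zero_add, pow_add, ← pow_mul, mul_assoc]
  refine ⟨w, ∑ b ∈ T, C (PowerSeries.X ^ (E.q * n b + b * (E.q * a + E.m) - w)) * D b,
    hmin, ⟨b₁, hb₁, rfl⟩, ?_, ?_, ?_⟩
  · rw [Finset.mul_sum]
    refine Finset.sum_congr rfl fun b hb => ?_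
    rw [hterm b hb, ← mul_assoc (C _) (C _) (D b), ← Polynomial.C_mul,
      ← pow_add, Nat.add_sub_cancel' (hmin b hb)]
  · intro hlt
    rw [hval]
    exact sum_root_pow_ne_zero γ e E.q_pos rfl hz hMne hγ0 hexp
      fun b hb => hlt b (Finset.mem_filter.1 hb).1
  · intro hq hℓ h0 hder
    rw [hval] at h0
    refine sum_mul_root_pow_ne_zero γ e E.q_pos rfl hz hMne hγ0 hexp
      (fun b hbM => hb b (Finset.mem_filter.1 hbM).1) hq hℓ h0 ?_
    -- multiplying by `z^s` repairs the exponent lowered by the derivative of `(y + z^s)^b`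
    have h1 : E.z ^ E.s * (Polynomial.derivative (∑ b ∈ M, reduction (D b))).eval 0 = 0 := by
      rw [← hredsum, hder, mul_zero]
    rw [← h1, Polynomial.derivative_sum, Polynomial.eval_finsetSum, Finset.mul_sum]
    refine Finset.sum_congr rfl fun b _ => ?_
    rw [hred]
    rcases b with _ | b
    · rw [pow_zero, mul_one, Polynomial.derivative_C]
      simp
    · simp only [Polynomial.derivative_C_mul, Polynomial.derivative_X_add_C_pow,
        Polynomial.eval_mul, Polynomial.eval_C, Polynomial.eval_pow, Polynomial.eval_add,
        Polynomial.eval_X, zero_add, Nat.add_sub_cancel, he]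
      change _ * (_ * E.z ^ _) = _
      simp only [pow_add, mul_add, mul_one, ← pow_mul]
      ring

end EdgeData

/-! ### Adic expansions and minimal polynomials -/

section Adic

variable {R : Type*} [CommRing R] [IsDomain R] {φ : Polynomial R} {d : ℕ}

lemma exists_adic_expansion (hφ : φ.Monic) (hd : φ.natDegree = d) (r : ℕ) (G : Polynomial R)
    (hG : G.degree < (d * r : ℕ)) :
    ∃ A : ℕ → Polynomial R, (∀ j, (A j).degree < d) ∧ G = ∑ j ∈ Finset.range r, A j * φ ^ j := by
  induction r generalizing G with
  | zero =>
    refine ⟨fun _ => 0, fun _ => by simp, ?_⟩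
    have : G = 0 := by
      rw [← Polynomial.degree_eq_bot]
      simpa [Nat.WithBot.lt_zero_iff] using hG
    simp [this]
  | succ r ih =>
    have hdeg : (G %ₘ φ).degree < d := by
      have := Polynomial.degree_modByMonic_lt G hφ
      rwa [Polynomial.degree_eq_natDegree hφ.ne_zero, hd] at this
    obtain ⟨A, hA, hsum⟩ := ih (G /ₘ φ) (by
      rcases eq_or_ne (G /ₘ φ) 0 with h0 | h0
      · rw [h0, Polynomial.degree_zero]
        exact WithBot.bot_lt_coe _
      · have hG0 : G ≠ 0 := by
          rintro rfl
          simp at h0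
        rw [← Polynomial.natDegree_lt_iff_degree_lt hG0] at hG
        rw [← Polynomial.natDegree_lt_iff_degree_lt h0, Polynomial.natDegree_divByMonic G hφ, hd]
        have hle : d ≤ G.natDegree := by
          by_contra hc
          refine h0 ((Polynomial.divByMonic_eq_zero_iff hφ).2 ?_)
          refine Polynomial.degree_lt_degree ?_
          omega
        rw [mul_add] at hG
        omega)
    refine ⟨fun j => Nat.casesOn j (G %ₘ φ) A, fun j => ?_, ?_⟩
    · cases j with
      | zero => exact hdeg
      | succ j => exact hA j
    · rw [Finset.sum_range_succ']
      conv_lhs => rw [← Polynomial.modByMonic_add_div G φ, hsum, Finset.mul_sum, add_comm]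
      simp only [pow_zero, mul_one, pow_succ]
      congr 1
      exact Finset.sum_congr rfl fun j _ => by ring

lemma degree_adic_sum_lt (hφ : φ.Monic) (hd : φ.natDegree = d) {r : ℕ}
    {A : ℕ → Polynomial R} (hA : ∀ j ∈ Finset.range r, (A j).degree < d) :
    (∑ j ∈ Finset.range r, A j * φ ^ j).degree < (d * r : ℕ) := by
  refine (Polynomial.degree_sum_le _ _).trans_lt ((Finset.sup_lt_iff (WithBot.bot_lt_coe _)).2 ?_)
  intro j hj
  rcases eq_or_ne (A j) 0 with h0 | h0
  · rw [h0, zero_mul, Polynomial.degree_zero]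
    exact WithBot.bot_lt_coe _
  · have h1 := hA j hj
    rw [← Polynomial.natDegree_lt_iff_degree_lt h0] at h1
    rw [← Polynomial.natDegree_lt_iff_degree_lt (mul_ne_zero h0 (hφ.pow j).ne_zero),
      Polynomial.natDegree_mul h0 (hφ.pow j).ne_zero, hφ.natDegree_pow, hd]
    have h2 : j + 1 ≤ r := Finset.mem_range.1 hj
    have h3 := Nat.mul_le_mul_left d h2
    rw [mul_add, mul_comm d j] at h3
    omega

lemma adic_expansion_unique (hφ : φ.Monic) (hd : φ.natDegree = d) {r : ℕ}
    {A : ℕ → Polynomial R} (hA : ∀ j ∈ Finset.range r, (A j).degree < d)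
    (h0 : ∑ j ∈ Finset.range r, A j * φ ^ j = 0) : ∀ j ∈ Finset.range r, A j = 0 := by
  induction r generalizing A with
  | zero => simp
  | succ r ih =>
    rw [Finset.sum_range_succ', pow_zero, mul_one] at h0
    have h1 : φ * ∑ j ∈ Finset.range r, A (j + 1) * φ ^ j + A 0 = 0 := by
      rw [← h0, Finset.mul_sum]
      congr 1
      exact Finset.sum_congr rfl fun j _ => by ring
    have hA0 : A 0 = 0 := by
      by_contra hne
      refine hφ.not_dvd_of_degree_lt hne ?_ (Dvd.intro (-∑ j ∈ Finset.range r, A (j + 1) * φ ^ j) ?_)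
      · rw [Polynomial.degree_eq_natDegree hφ.ne_zero, hd]
        exact hA 0 (by simp)
      · rw [mul_neg]
        exact neg_eq_of_add_eq_zero_right h1
    rw [hA0, add_zero] at h1
    have h2 := ih (A := fun j => A (j + 1)) (fun j hj => hA _ (by simpa using hj))
      ((mul_eq_zero.1 h1).resolve_left hφ.ne_zero)
    intro j hj
    cases j with
    | zero => exact hA0
    | succ j => exact h2 j (by simpa using hj)

end Adic

section Minpoly

variable {R S T : Type*} [CommRing R] [CommRing S] [CommRing T]

/-- `S` is generated by `n` elements as a module over `R`, through `θ : R → S`. -/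
def IsSpannedBy (θ : R →+* S) (n : ℕ) : Prop :=
  ∃ v : Fin n → S, ∀ s, ∃ a : Fin n → R, s = ∑ i, θ (a i) * v i

lemma IsSpannedBy.comp {θ : R →+* S} {η : S →+* T} {m n : ℕ} (hη : IsSpannedBy η m)
    (hθ : IsSpannedBy θ n) : IsSpannedBy (η.comp θ) (n * m) := by
  obtain ⟨v, hv⟩ := hθ
  obtain ⟨w, hw⟩ := hη
  choose a ha using hv
  refine ⟨fun i => η (v (finProdFinEquiv.symm i).1) * w (finProdFinEquiv.symm i).2, fun t => ?_⟩
  obtain ⟨b, rfl⟩ := hw t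
  refine ⟨fun i => a (b (finProdFinEquiv.symm i).2) (finProdFinEquiv.symm i).1, ?_⟩
  rw [← finProdFinEquiv.sum_comp, Fintype.sum_prod_type, Finset.sum_comm]
  refine Finset.sum_congr rfl fun j _ => ?_
  conv_lhs => rw [ha (b j), map_sum, Finset.sum_mul]
  refine Finset.sum_congr rfl fun i _ => ?_
  simp [mul_assoc]

/-- The Cayley–Hamilton argument: an element of a domain generated by `n` elements over `R` is a
root of a monic polynomial of degree `n`. -/
lemma IsSpannedBy.exists_monic [Nontrivial R] [IsDomain S] {θ : R →+* S} {n : ℕ}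
    (hθ : IsSpannedBy θ n) (s : S) :
    ∃ p : Polynomial R, p.Monic ∧ p.natDegree = n ∧ p.eval₂ θ s = 0 := by
  obtain ⟨v, hv⟩ := hθ
  choose M hM using fun i => hv (s * v i)
  refine ⟨(Matrix.of M).charpoly, Matrix.charpoly_monic _, by simp, ?_⟩
  have hv0 : v ≠ 0 := by
    rintro rfl
    obtain ⟨a, ha⟩ := hv 1
    simp at ha
  rw [← Polynomial.eval_map, ← Matrix.charpoly_map, Matrix.eval_charpoly]
  refine Matrix.exists_mulVec_eq_zero_iff.1 ⟨v, hv0, ?_⟩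
  rw [Matrix.sub_mulVec, sub_eq_zero]
  ext i
  rw [Matrix.scalar_apply, Matrix.mulVec_diagonal, hM i]
  rfl

lemma isSpannedBy_substX {L L' : Type u} [Field L] [Field L'] (ι : L →+* L') {μ : L'}
    (hμ : μ ≠ 0) {q : ℕ} (hq : q ≠ 0) {n : ℕ} (hι : IsSpannedBy ι n) :
    IsSpannedBy (substX ι μ q hq) (n * q) := by
  obtain ⟨v, hv⟩ := hι
  choose a ha using hv
  refine ⟨fun i => PowerSeries.C (v (finProdFinEquiv.symm i).1) *
    PowerSeries.X ^ ((finProdFinEquiv.symm i).2 : ℕ), fun s => ?_⟩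
  refine ⟨fun i => PowerSeries.mk fun l => a ((μ ^ l)⁻¹ *
    PowerSeries.coeff (q * l + (finProdFinEquiv.symm i).2) s) (finProdFinEquiv.symm i).1, ?_⟩
  rw [← finProdFinEquiv.sum_comp, Fintype.sum_prod_type, Finset.sum_comm]
  simp only [Equiv.symm_apply_apply]
  ext N
  have hqpos : 0 < q := Nat.pos_of_ne_zero hq
  rw [map_sum, Finset.sum_eq_single ⟨N % q, Nat.mod_lt _ hqpos⟩]
  · rw [map_sum]
    have hN : N = q * (N / q) + N % q := (Nat.div_add_mod N q).symm
    have h1 : ∀ i : Fin n, PowerSeries.coeff N (substX ι μ q hq (PowerSeries.mk fun l =>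
        a ((μ ^ l)⁻¹ * PowerSeries.coeff (q * l + N % q) s) i) *
        (PowerSeries.C (v i) * PowerSeries.X ^ (N % q))) =
        μ ^ (N / q) * (ι (a ((μ ^ (N / q))⁻¹ * PowerSeries.coeff N s) i) * v i) := by
      intro i
      rw [← mul_assoc, PowerSeries.coeff_mul_X_pow', if_pos (Nat.mod_le _ _),
        PowerSeries.coeff_mul_C]
      have : N - N % q = q * (N / q) := by omega
      rw [this, coeff_substX_mul, PowerSeries.coeff_mk, ← hN, mul_assoc]
    rw [Finset.sum_congr rfl fun i _ => h1 i, ← Finset.mul_sum, ← ha, mul_inv_cancel_left₀]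
    exact pow_ne_zero _ hμ
  · intro j _ hj
    rw [map_sum]
    refine Finset.sum_eq_zero fun i _ => ?_
    rw [← mul_assoc, PowerSeries.coeff_mul_X_pow']
    split_ifs with hle
    · rw [PowerSeries.coeff_mul_C]
      have : ¬ q ∣ N - j := by
        rintro ⟨l, hl⟩
        apply hj
        have : N = j + q * l := by omega
        ext
        simp [this, Nat.mod_eq_of_lt j.2]
      simp [substX, PowerSeries.coeff_expand_of_not_dvd _ _ _ this]
    · rfl
  · simp

lemma isSpannedBy_adjoinRoot {L : Type u} [Field L] {P : Polynomial L} (hP : P.Monic) :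
    IsSpannedBy (AdjoinRoot.of P) P.natDegree := by
  refine ⟨fun i => AdjoinRoot.root P ^ (i : ℕ), fun s => ?_⟩
  obtain ⟨f, rfl⟩ := AdjoinRoot.mk_surjective s
  refine ⟨fun i => (f %ₘ P).coeff i, ?_⟩
  have h1 : AdjoinRoot.mk P f = AdjoinRoot.mk P (f %ₘ P) := by
    rw [AdjoinRoot.mk_eq_mk]
    refine ⟨f /ₘ P, ?_⟩
    rw [sub_eq_iff_eq_add, add_comm]
    exact (Polynomial.modByMonic_add_div f P).symm
  rw [h1]
  rcases eq_or_ne P 1 with h | hne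
  · have : f %ₘ P = 0 := by rw [h, Polynomial.modByMonic_one]
    simp [this]
  conv_lhs => rw [(f %ₘ P).as_sum_range' P.natDegree (Polynomial.natDegree_modByMonic_lt f hP hne)]
  rw [map_sum, Finset.sum_range]
  refine Finset.sum_congr rfl fun i _ => ?_
  rw [← Polynomial.C_mul_X_pow_eq_monomial, map_mul, map_pow, AdjoinRoot.mk_C, AdjoinRoot.mk_X]

/-- The minimal polynomial of `s ∈ S` over `R`, which acts on `S` through `θ : R → S`. -/
def minpolyThrough (θ : R →+* S) (s : S) : Polynomial R :=
  @minpoly R S _ _ θ.toAlgebra s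

lemma minpolyThrough_spec [IsDomain R] {θ : R →+* S} {s : S} {n : ℕ}
    (hex : ∃ p : Polynomial R, p.Monic ∧ p.natDegree = n ∧ p.eval₂ θ s = 0)
    (hlow : ∀ p : Polynomial R, p ≠ 0 → p.degree < n → p.eval₂ θ s ≠ 0) :
    (minpolyThrough θ s).Monic ∧ (minpolyThrough θ s).natDegree = n ∧
      (minpolyThrough θ s).eval₂ θ s = 0 := by
  let _ := θ.toAlgebra
  obtain ⟨p, hp, hpn, hp0⟩ := hex
  have hint : IsIntegral R s := ⟨p, hp, hp0⟩
  have hmon : (minpoly R s).Monic := minpoly.monic hint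
  have h0 : (minpoly R s).eval₂ θ s = 0 := minpoly.aeval R s
  refine ⟨hmon, le_antisymm ?_ ?_, h0⟩
  · exact hpn ▸ Polynomial.natDegree_le_natDegree (minpoly.min R s hp hp0)
  · by_contra hc
    refine hlow _ hmon.ne_zero ?_ h0
    rw [← Polynomial.natDegree_lt_iff_degree_lt hmon.ne_zero]
    exact not_le.1 hc

end Minpoly

/-! ### Weierstrass preparation -/

section Preparation

variable {L : Type u} [Field L]

instance : IsAdicComplete (IsLocalRing.maximalIdeal (PowerSeries L)) (PowerSeries L) := by
  rw [PowerSeries.maximalIdeal_eq_span_X]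
  infer_instance

lemma mem_maximalIdeal_iff (a : PowerSeries L) :
    a ∈ IsLocalRing.maximalIdeal (PowerSeries L) ↔ PowerSeries.constantCoeff a = 0 := by
  rw [PowerSeries.maximalIdeal_eq_span_X, Ideal.mem_span_singleton, PowerSeries.X_dvd_iff]

lemma IsWeierstrass.isDistinguishedAt {G : Polynomial (PowerSeries L)} (hG : IsWeierstrass G) :
    G.IsDistinguishedAt (IsLocalRing.maximalIdeal (PowerSeries L)) where
  monic := hG.1
  mem hi := (mem_maximalIdeal_iff _).2 (hG.2 _ hi)

/-- The Weierstrass polynomial of a polynomial that does not vanish at `x = 0` exists, and the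
cofactor, a priori a power series, is a polynomial. -/
lemma exists_weierstrassFactor (n : ℕ) {A : Polynomial (PowerSeries L)}
    (hA : reduction A ≠ 0) :
    IsWeierstrass (weierstrassFactor n (C (PowerSeries.X ^ n) * A)) ∧
    ∃ V : Polynomial (PowerSeries L), originEval V ≠ 0 ∧
      A = weierstrassFactor n (C (PowerSeries.X ^ n) * A) * V := by
  have hex : ∃ G : Polynomial (PowerSeries L), IsWeierstrass G ∧
      ∃ V : PowerSeries (PowerSeries L), IsUnit V ∧
        ((C (PowerSeries.X ^ n) * A : Polynomial (PowerSeries L)) :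
          PowerSeries (PowerSeries L)) =
          PowerSeries.C ((PowerSeries.X : PowerSeries L) ^ n) *
            (G : PowerSeries (PowerSeries L)) * V := by
    have hne : (A : PowerSeries (PowerSeries L)).map
        (IsLocalRing.residue (PowerSeries L)) ≠ 0 := by
      intro h
      refine hA (Polynomial.ext fun i => ?_)
      have h1 := congrArg (PowerSeries.coeff i) h
      rw [PowerSeries.coeff_map, map_zero, Polynomial.coeff_coe,
        IsLocalRing.residue_eq_zero_iff, mem_maximalIdeal_iff] at h1
      rw [coeff_reduction, h1, Polynomial.coeff_zero]
    obtain ⟨G, V, hGV⟩ := PowerSeries.exists_isWeierstrassFactorization hne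
    refine ⟨G, ⟨hGV.isDistinguishedAt.monic, fun i hi =>
      (mem_maximalIdeal_iff _).1 (hGV.isDistinguishedAt.mem hi)⟩, V, hGV.isUnit, ?_⟩
    rw [Polynomial.coe_mul, Polynomial.coe_C, hGV.eq_mul, mul_assoc]
  rw [weierstrassFactor, dif_pos hex]
  obtain ⟨hG, V, hV, heq⟩ := hex.choose_spec
  set G := hex.choose
  refine ⟨hG, ?_⟩
  have heq' : (A : PowerSeries (PowerSeries L)) = (G : PowerSeries (PowerSeries L)) * V := by
    rw [Polynomial.coe_mul, Polynomial.coe_C, mul_assoc] at heq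
    refine mul_left_cancel₀ ?_ heq
    rw [Ne, map_eq_zero_iff _ PowerSeries.C_injective]
    exact pow_ne_zero _ PowerSeries.X_ne_zero
  have hd := hG.isDistinguishedAt
  have htop : IsLocalRing.maximalIdeal (PowerSeries L) ≠ ⊤ := Ideal.IsPrime.ne_top inferInstance
  have hord : ((G : PowerSeries (PowerSeries L)).map (Ideal.Quotient.mk
      (IsLocalRing.maximalIdeal (PowerSeries L)))).order.toNat = G.natDegree := by
    have := hd.coe_natDegree_eq_order_map (G : PowerSeries (PowerSeries L)) 1
      (by rwa [map_one, ← Ideal.ne_top_iff_one]) (by simp)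
    rw [← this]
    rfl
  -- comparison with the Euclidean division of `A` by the monic polynomial `G`
  have hdiv : (G : PowerSeries (PowerSeries L)) * V + ((0 : Polynomial (PowerSeries L)) :
      PowerSeries (PowerSeries L)) =
      (G : PowerSeries (PowerSeries L)) * ((A /ₘ G : Polynomial (PowerSeries L)) :
        PowerSeries (PowerSeries L)) + ((A %ₘ G : Polynomial (PowerSeries L)) :
        PowerSeries (PowerSeries L)) := by
    rw [Polynomial.coe_zero, add_zero, ← heq', ← Polynomial.coe_mul, ← Polynomial.coe_add,
      add_comm, Polynomial.modByMonic_add_div]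
  obtain ⟨hVeq, hR⟩ := (hd.isWeierstrassDivisorAt htop).eq_of_mul_add_eq_mul_add
    (by rw [Polynomial.degree_zero]; exact WithBot.bot_lt_coe _)
    (by
      rw [hord, ← Polynomial.degree_eq_natDegree hG.1.ne_zero]
      exact Polynomial.degree_modByMonic_lt A hG.1) hdiv
  refine ⟨A /ₘ G, ?_, ?_⟩
  · rw [hVeq, PowerSeries.isUnit_iff_constantCoeff, PowerSeries.isUnit_iff_constantCoeff,
      Polynomial.constantCoeff_coe, isUnit_iff_ne_zero] at hV
    rwa [originEval_apply]
  · conv_lhs => rw [← Polynomial.modByMonic_add_div A G, ← hR, zero_add]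

end Preparation

/-! ### Lower convex hulls and Newton polygons -/

section Hull

lemma mem_lowerConvexHull_of_minimizes {S : Set (ℝ × ℝ)} {p : ℝ × ℝ} (hp : p ∈ S) {α β : ℝ}
    (hβ : 0 < β) (hmin : ∀ s ∈ S, α * p.1 + β * p.2 ≤ α * s.1 + β * s.2) :
    p ∈ lowerConvexHull S := by
  refine ⟨subset_convexHull ℝ S hp, fun t ht => ?_⟩
  have hconv : Convex ℝ {s : ℝ × ℝ | α * p.1 + β * p.2 ≤ α * s.1 + β * s.2} := by
    intro x hx y hy a b ha hb hab
    simp only [Set.mem_ofPred_eq, Prod.fst_add, Prod.snd_add, Prod.smul_fst, Prod.smul_snd,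
      smul_eq_mul] at hx hy ⊢
    have h1 := mul_le_mul_of_nonneg_left hx ha
    have h2 := mul_le_mul_of_nonneg_left hy hb
    have h3 : α * p.1 + β * p.2 = a * (α * p.1 + β * p.2) + b * (α * p.1 + β * p.2) := by
      rw [← add_mul, hab, one_mul]
    rw [h3]
    linarith
  have h : α * p.1 + β * p.2 ≤ α * p.1 + β * t := convexHull_min (fun s hs => hmin s hs) hconv ht
  exact le_of_mul_le_mul_left (by linarith) hβ

/-- The lower convex hull only depends on the upward closure of the convex hull. -/
lemma lowerConvexHull_eq_of_forall_exists {S T : Set (ℝ × ℝ)}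
    (hST : ∀ p ∈ S, ∃ t ≤ p.2, (p.1, t) ∈ convexHull ℝ T)
    (hTS : ∀ p ∈ T, ∃ t ≤ p.2, (p.1, t) ∈ convexHull ℝ S) :
    lowerConvexHull S = lowerConvexHull T := by
  have key : ∀ {A B : Set (ℝ × ℝ)}, (∀ p ∈ A, ∃ t ≤ p.2, (p.1, t) ∈ convexHull ℝ B) →
      ∀ p ∈ convexHull ℝ A, ∃ t ≤ p.2, (p.1, t) ∈ convexHull ℝ B := by
    intro A B h p hp
    have hconv : Convex ℝ {p : ℝ × ℝ | ∃ t ≤ p.2, (p.1, t) ∈ convexHull ℝ B} := by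
      rintro x ⟨s, hs, hsB⟩ y ⟨t, ht, htB⟩ a b ha hb hab
      refine ⟨a * s + b * t, ?_, ?_⟩
      · simp only [Prod.snd_add, Prod.smul_snd, smul_eq_mul]
        exact add_le_add (mul_le_mul_of_nonneg_left hs ha) (mul_le_mul_of_nonneg_left ht hb)
      · exact convex_convexHull ℝ B hsB htB ha hb hab
    exact convexHull_min h hconv hp
  have sub : ∀ {A B : Set (ℝ × ℝ)}, (∀ p ∈ A, ∃ t ≤ p.2, (p.1, t) ∈ convexHull ℝ B) →
      (∀ p ∈ B, ∃ t ≤ p.2, (p.1, t) ∈ convexHull ℝ A) →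
      lowerConvexHull A ⊆ lowerConvexHull B := by
    rintro A B hAB hBA p ⟨hp, hmin⟩
    obtain ⟨t, ht, htB⟩ := key hAB p hp
    obtain ⟨t', ht', htA⟩ := key hBA _ htB
    have h1 := hmin t' htA
    have h2 : t = p.2 := le_antisymm ht (h1.trans ht')
    refine ⟨by rwa [h2] at htB, fun s hs => ?_⟩
    obtain ⟨s', hs', hsA⟩ := key hBA _ hs
    exact (hmin s' hsA).trans hs'
  exact Set.Subset.antisymm (sub hST hTS) (sub hTS hST)

/-- A point dominated by `p' ∈ T` lies above the segment that joins `p'` to `(n, 0)`. -/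
lemma exists_le_mem_convexHull {T : Set (ℝ × ℝ)} {n : ℝ} (hn : (n, (0 : ℝ)) ∈ T) {p p' : ℝ × ℝ}
    (hp' : p' ∈ T) (h1 : p'.1 ≤ p.1) (h2 : p'.2 ≤ p.2) (hpn : p.1 ≤ n) (h0 : 0 ≤ p'.2) :
    ∃ t ≤ p.2, (p.1, t) ∈ convexHull ℝ T := by
  rcases eq_or_lt_of_le (h1.trans hpn) with h | h
  · refine ⟨p'.2, h2, ?_⟩
    have : p.1 = p'.1 := le_antisymm (h ▸ hpn) h1
    rw [this]
    exact subset_convexHull ℝ T hp'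
  · have hpos : 0 < n - p'.1 := sub_pos.2 h
    set l := (p.1 - p'.1) / (n - p'.1) with hl
    have hl0 : 0 ≤ l := div_nonneg (sub_nonneg.2 h1) hpos.le
    have hl1 : l ≤ 1 := (div_le_one hpos).2 (by linarith)
    refine ⟨(1 - l) * p'.2, ?_, ?_⟩
    · have : (1 - l) * p'.2 ≤ 1 * p'.2 := mul_le_mul_of_nonneg_right (by linarith) h0
      linarith
    · have h3 := convex_convexHull ℝ T (subset_convexHull ℝ T hp') (subset_convexHull ℝ T hn)
        (sub_nonneg.2 hl1) hl0 (by ring)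
      convert h3 using 1
      ext
      · simp only [Prod.fst_add, Prod.smul_fst, smul_eq_mul]
        have : l * (n - p'.1) = p.1 - p'.1 := div_mul_cancel₀ _ hpos.ne'
        linarith
      · simp

end Hull

section NewtonPolygon

variable {L : Type u} [Field L] {G : Polynomial (PowerSeries L)}

/-- The points whose lower convex hull is the Newton polygon. -/
abbrev newtonPoints (G : Polynomial (PowerSeries L)) : Set (ℝ × ℝ) :=
  graphPoints G.natDegree (fun i => ENat.map (fun n : ℕ => (n : ℤ)) (G.coeff i).order)

lemma mem_newtonPoints_iff {p : ℝ × ℝ} : p ∈ newtonPoints G ↔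
    ∃ i ≤ G.natDegree, ∃ n : ℕ, (G.coeff i).order = n ∧ p = ((i : ℝ), (n : ℝ)) := by
  constructor
  · rintro ⟨i, hi, j, hj, rfl⟩
    refine ⟨i, hi, ?_⟩
    beta_reduce at hj
    cases h : (G.coeff i).order with
    | top =>
      rw [h] at hj
      exact absurd hj (by simp)
    | coe n =>
      refine ⟨n, rfl, ?_⟩
      rw [h, ENat.map_natCast] at hj
      have : (n : ℤ) = j := WithTop.coe_injective hj
      rw [← this]
      simp
  · rintro ⟨i, hi, n, hn, rfl⟩
    refine ⟨i, hi, n, ?_, by simp⟩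
    beta_reduce
    rw [hn, ENat.map_natCast]

lemma finite_newtonPoints : (newtonPoints G).Finite := by
  refine ((Finset.range (G.natDegree + 1)).image
    fun i : ℕ => ((i : ℝ), ((G.coeff i).order.toNat : ℝ))).finite_toSet.subset ?_
  intro p hp
  obtain ⟨i, hi, n, hn, rfl⟩ := mem_newtonPoints_iff.1 hp
  simp only [Finset.coe_image, Set.mem_image, Finset.mem_coe, Finset.mem_range]
  exact ⟨i, Nat.lt_succ_of_le hi, by rw [hn]; rfl⟩

lemma coeff_boundaryPolynomial {i j : ℕ} (hi : i ≤ G.natDegree)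
    (h : ((i : ℝ), (j : ℝ)) ∈ newtonPolygon G) :
    PowerSeries.coeff j ((boundaryPolynomial G).coeff i) = PowerSeries.coeff j (G.coeff i) := by
  rw [boundaryPolynomial, Polynomial.finsetSum_coeff, Finset.sum_eq_single i]
  · rw [Polynomial.coeff_monomial, if_pos rfl, PowerSeries.coeff_mk, if_pos h]
  · intro b _ hb
    rw [Polynomial.coeff_monomial, if_neg hb]
  · intro h
    exact absurd (Finset.mem_range.2 (Nat.lt_succ_of_le hi)) h

lemma natDegree_boundaryPolynomial_le : (boundaryPolynomial G).natDegree ≤ G.natDegree :=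
  Polynomial.natDegree_sum_le_of_forall_le _ _ fun _ hi =>
    (Polynomial.natDegree_monomial_le _).trans (Nat.lt_succ_iff.1 (Finset.mem_range.1 hi))

lemma natDegree_mem_newtonPoints_of_monic (hG : G.Monic) :
    ((G.natDegree : ℝ), (0 : ℝ)) ∈ newtonPoints G :=
  mem_newtonPoints_iff.2 ⟨_, le_rfl, 0, by simp [hG], by simp⟩

lemma natDegree_mem_newtonPolygon_of_monic (hG : G.Monic) :
    ((G.natDegree : ℝ), (0 : ℝ)) ∈ newtonPolygon G := by
  refine mem_lowerConvexHull_of_minimizes (natDegree_mem_newtonPoints_of_monic hG) (α := 0) one_pos ?_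
  intro s hs
  obtain ⟨i, _, n, _, rfl⟩ := mem_newtonPoints_iff.1 hs
  simp

/-- A Weierstrass polynomial other than a power of `y` has a vertex on the left of its leading
term: the one of least abscissa. -/
lemma IsWeierstrass.exists_vertex (hG : IsWeierstrass G) (hne : G ≠ Polynomial.X ^ G.natDegree) :
    ∃ i < G.natDegree, ∃ j : ℕ, 0 < j ∧ PowerSeries.coeff j (G.coeff i) ≠ 0 ∧
      ((i : ℝ), (j : ℝ)) ∈ newtonPolygon G := by
  classical
  have hex : ∃ i, i < G.natDegree ∧ G.coeff i ≠ 0 := by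
    by_contra hcon
    push Not at hcon
    refine hne (Polynomial.ext fun i => ?_)
    rw [Polynomial.coeff_X_pow]
    rcases lt_trichotomy i G.natDegree with h | h | h
    · rw [hcon i h, if_neg h.ne]
    · rw [if_pos h, h, Polynomial.coeff_natDegree, hG.1.leadingCoeff]
    · rw [if_neg h.ne', Polynomial.coeff_eq_zero_of_natDegree_lt h]
  obtain ⟨hi, hi0⟩ := Nat.find_spec hex
  set i := Nat.find hex with hidef
  obtain ⟨j, hj, b, hb, hb0⟩ := exists_eq_X_pow_mul hi0
  refine ⟨i, hi, j, ?_, ?_, ?_⟩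
  · refine Nat.pos_of_ne_zero fun h0 => hb0 ?_
    have := hG.2 i hi
    rwa [hb, h0, pow_zero, one_mul] at this
  · rw [hb, PowerSeries.coeff_X_pow_mul', if_pos le_rfl, Nat.sub_self]
    simpa using hb0
  · -- the linear form `j X + Y` is minimal at `(i, j)` since the other abscissas exceed `i`
    refine mem_lowerConvexHull_of_minimizes (mem_newtonPoints_iff.2 ⟨i, hi.le, j, hj, rfl⟩)
      (α := j) one_pos ?_
    intro s hs
    obtain ⟨l, hl, n, hn, rfl⟩ := mem_newtonPoints_iff.1 hs
    have hlne : G.coeff l ≠ 0 := by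
      intro h
      rw [h, PowerSeries.order_zero] at hn
      exact absurd hn (by simp)
    have hil : i ≤ l := by
      by_contra hc
      exact Nat.find_min hex (not_le.1 hc) ⟨(not_le.1 hc).trans hi, hlne⟩
    rcases eq_or_lt_of_le hil with h | h
    · subst h
      rw [hj] at hn
      have : j = n := by exact_mod_cast hn
      simp [this]
    · have h1 : (i : ℝ) + 1 ≤ l := by exact_mod_cast h
      have h2 : (j : ℝ) * (i + 1) ≤ j * l := mul_le_mul_of_nonneg_left h1 (by positivity)
      have h3 : (0 : ℝ) ≤ n := by positivity
      simp only
      linarith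

namespace EdgeData

variable (E : EdgeData G)

lemma natDegree_quasiHomogeneous_le :
    (quasiHomogeneous E.q E.m E.P).natDegree ≤ E.q * E.P.natDegree :=
  Polynomial.natDegree_sum_le_of_forall_le _ _ fun _ hj =>
    (Polynomial.natDegree_monomial_le _).trans
      (Nat.mul_le_mul_left _ (Nat.lt_succ_iff.1 (Finset.mem_range.1 hj)))

lemma coeff_quasiHomogeneous :
    (quasiHomogeneous E.q E.m E.P).coeff (E.q * E.P.natDegree) = 1 := by
  rw [quasiHomogeneous, Polynomial.finsetSum_coeff, Finset.sum_eq_single E.P.natDegree]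
  · rw [Polynomial.coeff_monomial, if_pos rfl, Nat.sub_self, mul_zero,
      Polynomial.coeff_natDegree, E.monic.leadingCoeff,
      PowerSeries.monomial_zero_eq_C_apply, map_one]
  · intro j _ hj
    rw [Polynomial.coeff_monomial, if_neg fun h => hj (Nat.eq_of_mul_eq_mul_left E.q_pos h)]
  · simp

lemma monic_quasiHomogeneous : (quasiHomogeneous E.q E.m E.P).Monic :=
  Polynomial.monic_of_natDegree_le_of_coeff_eq_one _ E.natDegree_quasiHomogeneous_le
    E.coeff_quasiHomogeneous

lemma natDegree_quasiHomogeneous :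
    (quasiHomogeneous E.q E.m E.P).natDegree = E.q * E.P.natDegree :=
  le_antisymm E.natDegree_quasiHomogeneous_le
    (Polynomial.le_natDegree_of_ne_zero (by rw [E.coeff_quasiHomogeneous]; exact one_ne_zero))

lemma natDegree_eq (hG : G.Monic) : G.natDegree = E.q * E.P.natDegree * E.N := by
  obtain ⟨c, hc, hbd⟩ := E.boundary
  have h1 : (boundaryPolynomial G).natDegree = G.natDegree := by
    refine le_antisymm natDegree_boundaryPolynomial_le (Polynomial.le_natDegree_of_ne_zero ?_)
    intro h0
    have := coeff_boundaryPolynomial (j := 0) (le_refl G.natDegree)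
      (by simpa using natDegree_mem_newtonPolygon_of_monic hG)
    rw [h0, Polynomial.coeff_natDegree, hG.leadingCoeff] at this
    simp at this
  have hc' : (PowerSeries.C c : PowerSeries L) ≠ 0 := by
    rwa [Ne, map_eq_zero_iff _ PowerSeries.C_injective]
  rw [← h1, hbd, Polynomial.natDegree_C_mul hc', E.monic_quasiHomogeneous.natDegree_pow,
    E.natDegree_quasiHomogeneous, mul_comm]

lemma mul_natDegree_eq (hG : G.Monic) {p : ℝ × ℝ} (hp : p ∈ newtonPolygon G) :
    (E.m : ℝ) * p.1 + E.q * p.2 = E.m * G.natDegree := by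
  obtain ⟨b, hb⟩ := E.straight
  have := hb _ (natDegree_mem_newtonPolygon_of_monic hG)
  rw [hb p hp, ← this]
  simp

/-- All terms of `G` lie on or above the line that carries the edge. -/
lemma le_of_order_eq (hG : G.Monic) {i n : ℕ} (hn : (G.coeff i).order = n) :
    E.m * G.natDegree ≤ E.m * i + E.q * n := by
  have hi : i ≤ G.natDegree := by
    by_contra hc
    rw [Polynomial.coeff_eq_zero_of_natDegree_lt (not_le.1 hc), PowerSeries.order_zero] at hn
    exact absurd hn (by simp)
  obtain ⟨p, hp, hmin⟩ := (finite_newtonPoints (G := G)).exists_minimalFor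
    (fun p : ℝ × ℝ => (E.m : ℝ) * p.1 + E.q * p.2) _
    ⟨_, natDegree_mem_newtonPoints_of_monic hG⟩
  have hle : ∀ s ∈ newtonPoints G, (E.m : ℝ) * p.1 + E.q * p.2 ≤ E.m * s.1 + E.q * s.2 :=
    fun s hs => (le_total _ _).elim id fun h => hmin hs h
  have h1 := E.mul_natDegree_eq hG
    (mem_lowerConvexHull_of_minimizes hp (by exact_mod_cast E.q_pos) hle)
  have h2 := hle _ (mem_newtonPoints_iff.2 ⟨i, hi, n, hn, rfl⟩)
  rw [h1] at h2
  simp only at h2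
  exact_mod_cast h2

/-- If `P = Z`, the boundary polynomial is reduced to the leading term. -/
lemma P_ne_X (hG : IsWeierstrass G) (hne : G ≠ Polynomial.X ^ G.natDegree) :
    E.P ≠ Polynomial.X := by
  intro hP
  obtain ⟨i, hi, j, -, hij, hmem⟩ := hG.exists_vertex hne
  obtain ⟨c, -, hbd⟩ := E.boundary
  have hqh : quasiHomogeneous E.q E.m E.P = Polynomial.X ^ E.q := by
    rw [quasiHomogeneous, hP, Polynomial.natDegree_X]
    simp [Finset.sum_range_succ, Polynomial.coeff_X, ← Polynomial.C_mul_X_pow_eq_monomial,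
      PowerSeries.monomial_zero_eq_C_apply]
  have hn : E.q * E.N = G.natDegree := by rw [E.natDegree_eq hG.1, hP]; simp
  have h := coeff_boundaryPolynomial hi.le hmem
  rw [hbd, hqh, ← pow_mul, hn, Polynomial.coeff_C_mul, Polynomial.coeff_X_pow, if_neg hi.ne] at h
  exact hij (by simpa using h.symm)

lemma z_ne_zero (hG : IsWeierstrass G) (hne : G ≠ Polynomial.X ^ G.natDegree) : E.z ≠ 0 := by
  intro h
  refine E.P_ne_X hG hne ?_
  have h1 : E.P ∣ Polynomial.X := by
    rw [← AdjoinRoot.mk_eq_zero, AdjoinRoot.mk_X]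
    exact h
  exact Polynomial.eq_of_monic_of_associated E.monic Polynomial.monic_X
    (E.irreducible.associated_of_dvd Polynomial.irreducible_X h1)

lemma m_ne_zero (hG : IsWeierstrass G) (hne : G ≠ Polynomial.X ^ G.natDegree) : E.m ≠ 0 := by
  intro hm
  obtain ⟨i, -, j, hj, -, hmem⟩ := hG.exists_vertex hne
  have h := E.mul_natDegree_eq hG.1 hmem
  rw [hm] at h
  have hq : (E.q : ℝ) ≠ 0 := by exact_mod_cast E.q_pos.ne'
  have hj' : (j : ℝ) ≠ 0 := by exact_mod_cast hj.ne'
  simp [hq, hj'] at h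

/-- The substitution without shift: `σ(G) = x^(q m ℓ N) A`, where `A` does not vanish at `x = 0`
because it is monic. -/
lemma exists_sigmaPull_zero_eq (hG : G.Monic) :
    ∃ A : Polynomial (PowerSeries E.ResidueField), reduction A ≠ 0 ∧
      E.sigmaPull 0 G = C (PowerSeries.X ^ (E.q * E.m * E.P.natDegree * E.N)) * A ∧
      A.natDegree ≤ G.natDegree := by
  have hb : E.q * E.m * E.P.natDegree * E.N = E.m * G.natDegree := by
    rw [E.natDegree_eq hG]; ring
  have hsum : E.sigmaPull 0 G = ∑ i ∈ Finset.range (G.natDegree + 1),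
      C (substX (AdjoinRoot.of E.P) (E.z ^ E.t) E.q E.q_pos.ne' (G.coeff i)) *
        E.yImage 0 ^ i := by
    refine (congrArg (E.sigmaPull 0) G.as_sum_range_C_mul_X_pow).trans ?_
    simp [map_sum]
  have hterm : ∀ i, ∃ a : PowerSeries E.ResidueField,
      C (substX (AdjoinRoot.of E.P) (E.z ^ E.t) E.q E.q_pos.ne' (G.coeff i)) * E.yImage 0 ^ i =
        C (PowerSeries.X ^ (E.m * G.natDegree)) * (C a *
          (Polynomial.X + C (PowerSeries.C (E.z ^ E.s) + 0)) ^ i) ∧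
        (i = G.natDegree → a = 1) := by
    intro i
    rcases eq_or_ne (G.coeff i) 0 with h0 | h0
    · refine ⟨0, by simp [h0], fun hi => ?_⟩
      rw [hi, Polynomial.coeff_natDegree, hG.leadingCoeff] at h0
      exact absurd h0 one_ne_zero
    · by_cases hi : i = G.natDegree
      · refine ⟨1, ?_, fun _ => rfl⟩
        rw [hi, Polynomial.coeff_natDegree, hG.leadingCoeff, yImage, mul_pow, map_one,
          ← Polynomial.C_pow, ← pow_mul, Polynomial.C_1, one_mul, one_mul]
      · obtain ⟨n, hn, b, hb, -⟩ := exists_eq_X_pow_mul h0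
        obtain ⟨l, hl⟩ := Nat.exists_eq_add_of_le (E.le_of_order_eq hG hn)
        refine ⟨PowerSeries.X ^ l * PowerSeries.C ((E.z ^ E.t) ^ n) *
          substX (AdjoinRoot.of E.P) (E.z ^ E.t) E.q E.q_pos.ne' b, ?_, fun h => absurd h hi⟩
        rw [hb, map_mul, substX_X_pow, yImage, mul_pow, ← Polynomial.C_pow,
          ← pow_mul PowerSeries.X]
        have : C (PowerSeries.X ^ (E.q * n)) * C (PowerSeries.X ^ (E.m * i)) =
            C (PowerSeries.X ^ (E.m * G.natDegree)) *
              C (PowerSeries.X ^ l : PowerSeries E.ResidueField) := by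
          rw [← Polynomial.C_mul, ← Polynomial.C_mul, ← pow_add, ← pow_add, ← hl, add_comm]
        simp only [Polynomial.C_mul]
        linear_combination (C (PowerSeries.C ((E.z ^ E.t) ^ n)) *
          C (substX (AdjoinRoot.of E.P) (E.z ^ E.t) E.q E.q_pos.ne' b) *
          (Polynomial.X + C (PowerSeries.C (E.z ^ E.s) + 0)) ^ i) * this
  choose a ha ha1 using hterm
  have hdeg : ∀ i, (C (a i) *
      (Polynomial.X + C (PowerSeries.C (E.z ^ E.s) + 0)) ^ i).natDegree ≤ i := by
    intro i
    refine (Polynomial.natDegree_C_mul_le _ _).trans ?_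
    rw [Polynomial.natDegree_pow, Polynomial.natDegree_X_add_C, mul_one]
  refine ⟨∑ i ∈ Finset.range (G.natDegree + 1), C (a i) *
    (Polynomial.X + C (PowerSeries.C (E.z ^ E.s) + 0)) ^ i, ?_, ?_, ?_⟩
  · intro h
    have h1 := congrArg (fun f => Polynomial.coeff f G.natDegree) h
    simp only [coeff_reduction, Polynomial.coeff_zero, Polynomial.finsetSum_coeff] at h1
    rw [Finset.sum_range_succ, Finset.sum_eq_zero, zero_add, ha1 _ rfl, Polynomial.C_1, one_mul,
      Polynomial.coeff_X_add_C_pow] at h1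
    · simp at h1
    · intro i hi
      exact Polynomial.coeff_eq_zero_of_natDegree_lt
        ((hdeg i).trans_lt (Finset.mem_range.1 hi))
  · rw [hsum, hb, Finset.mul_sum]
    exact Finset.sum_congr rfl fun i _ => ha i
  · exact Polynomial.natDegree_sum_le_of_forall_le _ _ fun i hi =>
      (hdeg i).trans (Nat.lt_succ_iff.1 (Finset.mem_range.1 hi))

/-- The Weierstrass polynomial of the next stage and its polynomial cofactor. -/
lemma exists_next (hG : G.Monic) :
    IsWeierstrass E.next ∧ E.next.natDegree ≤ G.natDegree ∧
    ∃ (n : ℕ) (V : Polynomial (PowerSeries E.ResidueField)), originEval V ≠ 0 ∧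
      E.sigmaPull 0 G = C (PowerSeries.X ^ n) * (E.next * V) := by
  obtain ⟨A, hA, heq, hdeg⟩ := E.exists_sigmaPull_zero_eq hG
  obtain ⟨hW, V, hV, hAV⟩ := exists_weierstrassFactor (E.q * E.m * E.P.natDegree * E.N) hA
  rw [← heq] at hW hAV
  refine ⟨hW, ?_, E.q * E.m * E.P.natDegree * E.N, V, hV, ?_⟩
  · refine le_trans ?_ hdeg
    have hA0 : A ≠ 0 := by
      rintro rfl
      simp at hA
    exact Polynomial.natDegree_le_of_dvd (Dvd.intro V hAV.symm) hA0
  · rw [heq]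
    congr 1

end EdgeData

end NewtonPolygon

/-! ### Sums over boxes of exponents -/

section Box

variable {R : Type*} [CommRing R] (φ : ℕ → Polynomial R) (r : ℕ → ℕ) (k : ℕ)

/-- The tails `(b_0, …, b_{k-1})` with `b_i < r_i`. -/
def box : Finset (Fin k → ℕ) := Fintype.piFinset fun i => Finset.range (r i)

/-- The sum `∑ a_b φ_0^(b_0) ⋯ φ_{k-1}^(b_{k-1})` over the box `b_i < r_i`. -/
def boxSum (a : (Fin k → ℕ) → R) : Polynomial R :=
  ∑ b ∈ box r k, C (a b) * ∏ i : Fin k, φ i ^ b i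

variable {r k} in
lemma mem_box {b : Fin k → ℕ} : b ∈ box r k ↔ ∀ i, b i < r i := by
  simp [box]

lemma box_succ : box r (k + 1) = (Finset.range (r k) ×ˢ box r k).image
    fun p => Fin.snoc (α := fun _ => ℕ) p.2 p.1 := by
  ext b
  simp only [Finset.mem_image, Finset.mem_product, Finset.mem_range, mem_box, Prod.exists]
  constructor
  · intro h
    exact ⟨b (Fin.last k), Fin.init b, ⟨h (Fin.last k), fun i => h i.castSucc⟩,
      Fin.snoc_init_self b⟩
  · rintro ⟨j, b', ⟨hj, hb'⟩, rfl⟩ i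
    refine Fin.lastCases ?_ (fun i => ?_) i
    · simpa using hj
    · simpa using hb' i

lemma boxSum_succ (a : (Fin (k + 1) → ℕ) → R) : boxSum φ r (k + 1) a =
    ∑ j ∈ Finset.range (r k), boxSum φ r k (fun b => a (Fin.snoc (α := fun _ => ℕ) b j)) *
      φ k ^ j := by
  rw [boxSum, box_succ, Finset.sum_image, Finset.sum_product]
  · refine Finset.sum_congr rfl fun j _ => ?_
    rw [boxSum, Finset.sum_mul]
    refine Finset.sum_congr rfl fun b _ => ?_
    rw [Fin.prod_univ_castSucc]
    simp [mul_assoc]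
  · rintro ⟨j, b⟩ _ ⟨j', b'⟩ _ h
    obtain ⟨h1, h2⟩ := Fin.snoc_injective2 h
    exact Prod.ext h2 h1

lemma inf_box_succ (f : (Fin (k + 1) → ℕ) → ℕ∞) : (box r (k + 1)).inf f =
    (Finset.range (r k)).inf fun j => (box r k).inf fun b =>
      f (Fin.snoc (α := fun _ => ℕ) b j) := by
  rw [box_succ, Finset.inf_image, Finset.inf_product_left]
  rfl

end Box

/-! ### The invariants of the algorithm -/

section Invariant

variable {K : Type u} [Field K]

/-- The action of `K[[x]]` on `L[[x]]` obtained from a pull-back, at `y = 0`. -/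
def baseHom {L : Type u} [Field L]
    (pull : Polynomial (PowerSeries K) →+* Polynomial (PowerSeries L)) :
    PowerSeries K →+* PowerSeries L :=
  ((Polynomial.evalRingHom 0).comp pull).comp C

/-- The properties of the pull-back `π_k^*`, of the transform `H = H_k` and of the family
`φ_0, …, φ_k` that are propagated by the algorithm; `r_i` stands for `q_{i+1} ℓ_{i+1}`, so that
`φ_k` has degree `∏_{i < k} r_i`. -/
structure StageInvariant (F : Polynomial (PowerSeries K)) (φ : ℕ → Polynomial (PowerSeries K))
    (r : ℕ → ℕ) (k : ℕ) {L : Type u} [Field L]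
    (pull : Polynomial (PowerSeries K) →+* Polynomial (PowerSeries L))
    (H : Polynomial (PowerSeries L)) : Prop where
  pull_C : ∀ a, pull (C a) = C (baseHom pull a)
  order_baseHom : ∃ e : ℕ, e ≠ 0 ∧ ∀ a, (baseHom pull a).order = e * a.order
  isSpannedBy : IsSpannedBy (baseHom pull) (∏ i ∈ Finset.range k, r i)
  monic : (φ k).Monic
  natDegree_eq : (φ k).natDegree = ∏ i ∈ Finset.range k, r i
  pull_phi : ∃ (a : ℕ) (U : Polynomial (PowerSeries L)), originEval U ≠ 0 ∧
    pull (φ k) = C (PowerSeries.X ^ a) * (Polynomial.X * U)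
  isRegular_phi : ∀ i < k, ∃ n, IsRegular (pull (φ i)) n
  isRegular : ∀ G : Polynomial (PowerSeries K), G ≠ 0 →
    G.degree < (∏ i ∈ Finset.range k, r i : ℕ) → ∃ n, IsRegular (pull G) n
  degree_boxSum : ∀ a, (boxSum φ r k a).degree < (∏ i ∈ Finset.range k, r i : ℕ)
  exists_boxSum : ∀ G : Polynomial (PowerSeries K),
    G.degree < (∏ i ∈ Finset.range k, r i : ℕ) → ∃ a, G = boxSum φ r k a
  xVal_boxSum : ∀ a, xVal (pull (boxSum φ r k a)) = (box r k).inf fun b =>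
    (baseHom pull (a b)).order + ∑ i : Fin k, (b i : ℕ∞) * xVal (pull (φ i))
  isWeierstrass : IsWeierstrass H
  natDegree_le : H.natDegree ≤ F.natDegree
  pull_eq : ∃ (v : ℕ) (V : Polynomial (PowerSeries L)), originEval V ≠ 0 ∧
    pull F = C (PowerSeries.X ^ v) * (H * V)

variable {F : Polynomial (PowerSeries K)} {φ : ℕ → Polynomial (PowerSeries K)}
  {r : ℕ → ℕ} {k : ℕ} {L : Type u} [Field L]
  {pull : Polynomial (PowerSeries K) →+* Polynomial (PowerSeries L)}
  {H : Polynomial (PowerSeries L)}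

lemma coeff_zero_pull_eq_eval₂ (G : Polynomial (PowerSeries K)) :
    (pull G).coeff 0 = G.eval₂ (baseHom pull) ((pull Polynomial.X).coeff 0) := by
  suffices h : (Polynomial.evalRingHom 0).comp pull =
      Polynomial.eval₂RingHom (baseHom pull) ((pull Polynomial.X).coeff 0) by
    have := congrArg (fun f => f G) h
    simpa [Polynomial.coeff_zero_eq_eval_zero] using this
  refine Polynomial.ringHom_ext (fun a => ?_) ?_
  · simp [baseHom]
  · simp [Polynomial.coeff_zero_eq_eval_zero]

namespace StageInvariant

/-- The kernel of the evaluation at the parametrisation `π_k(x, 0)` is generated by `φ_k`. -/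
lemma phi_dvd (h : StageInvariant F φ r k pull H) {G : Polynomial (PowerSeries K)}
    (hG : (pull G).coeff 0 = 0) : φ k ∣ G := by
  rw [← Polynomial.modByMonic_eq_zero_iff_dvd h.monic]
  by_contra hne
  have hdeg := Polynomial.degree_modByMonic_lt G h.monic
  rw [Polynomial.degree_eq_natDegree h.monic.ne_zero, h.natDegree_eq] at hdeg
  obtain ⟨n, hn⟩ := h.isRegular _ hne hdeg
  refine hn.coeff_zero_ne ?_
  obtain ⟨a, U, -, hU⟩ := h.pull_phi
  rw [Polynomial.modByMonic_eq_sub_mul_div, map_sub, map_mul, hU,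
    Polynomial.coeff_sub, hG]
  simp [Polynomial.mul_coeff_zero]

/-- Since `F` is square-free, its transforms are not powers of `y`: otherwise `y²` would divide
`π_k^* F`, and `φ_k²` would divide `F`. -/
lemma ne_X_pow (h : StageInvariant F φ r k pull H) (hsq : Squarefree F)
    (hH : 2 ≤ H.natDegree) : H ≠ Polynomial.X ^ H.natDegree := by
  intro hpow
  obtain ⟨v, V, -, hF⟩ := h.pull_eq
  obtain ⟨a, U, hU, hφ⟩ := h.pull_phi
  obtain ⟨n, hn⟩ := Nat.exists_eq_add_of_le hH
  rw [hpow, hn, pow_add] at hF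
  obtain ⟨Q, rfl⟩ : φ k ∣ F := by
    refine h.phi_dvd ?_
    rw [hF]
    simp [Polynomial.mul_coeff_zero]
  have hQ : φ k ∣ Q := by
    refine h.phi_dvd ?_
    rw [map_mul, hφ] at hF
    have hX : Polynomial.X * (C (PowerSeries.X ^ a) * U * pull Q) =
        Polynomial.X * (Polynomial.X * (C (PowerSeries.X ^ v) * (Polynomial.X ^ n * V))) := by
      linear_combination hF
    have h1 := congrArg (fun f => Polynomial.coeff f 0) (mul_left_cancel₀ Polynomial.X_ne_zero hX)
    simp only [Polynomial.mul_coeff_zero, Polynomial.coeff_X_zero, zero_mul,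
      Polynomial.coeff_C_zero] at h1
    refine (mul_eq_zero.1 h1).resolve_left (mul_ne_zero (pow_ne_zero _ PowerSeries.X_ne_zero) ?_)
    intro h0
    rw [originEval_apply, h0, map_zero] at hU
    exact hU rfl
  have hunit := hsq (φ k) (mul_dvd_mul_left _ hQ)
  have h1 := h.monic.eq_one_of_isUnit hunit
  rw [h1, map_one] at hφ
  have h2 := congrArg (fun f => Polynomial.coeff f 0) hφ
  simp [Polynomial.mul_coeff_zero] at h2

lemma degree_phi_pos (h : StageInvariant F φ r k pull H) : 0 < ∏ i ∈ Finset.range k, r i := by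
  refine Nat.pos_of_ne_zero fun h0 => ?_
  obtain ⟨a, U, -, hU⟩ := h.pull_phi
  rw [Polynomial.eq_one_of_monic_natDegree_zero h.monic (h.natDegree_eq.trans h0), map_one] at hU
  have h2 := congrArg (fun f => Polynomial.coeff f 0) hU
  simp [Polynomial.mul_coeff_zero] at h2

lemma natCast_ne_zero (h : StageInvariant F φ r k pull H)
    (hchar : ∀ n : ℕ, 0 < n → n ≤ F.natDegree → (n : K) ≠ 0) {n : ℕ} (hn : 0 < n)
    (hnH : n ≤ H.natDegree) : (n : L) ≠ 0 := by
  have h1 := hchar n hn (hnH.trans h.natDegree_le)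
  rw [← map_natCast (((PowerSeries.constantCoeff).comp (baseHom pull)).comp
    (PowerSeries.C (R := K)))]
  exact (map_ne_zero _).2 h1

variable (E : EdgeData H)

/-- The leading form of `π_{k+1}^* (∑ A_j φ_k^j)`, for coefficients `A_j` of degree less than
that of `φ_k`. -/
lemma exists_pull_adic_sum_eq (h : StageInvariant F φ r k pull H) (hm : E.m ≠ 0) (hz : E.z ≠ 0)
    {c : PowerSeries E.ResidueField} (hc : PowerSeries.constantCoeff c = 0) {N : ℕ}
    (hN : N ≤ E.q * E.P.natDegree + 1) {A : ℕ → Polynomial (PowerSeries K)}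
    (hA : ∀ j, (A j).degree < (∏ i ∈ Finset.range k, r i : ℕ))
    (hA0 : ∃ j ∈ Finset.range N, A j ≠ 0) :
    ∃ (w : ℕ) (B : Polynomial (PowerSeries E.ResidueField)),
      E.sigmaPull c (pull (∑ j ∈ Finset.range N, A j * φ k ^ j)) = C (PowerSeries.X ^ w) * B ∧
      ((Finset.range N).inf fun j => (E.q : ℕ∞) * xVal (pull (A j)) +
        j * xVal (E.sigmaPull c (pull (φ k)))) = w ∧
      (N ≤ E.q * E.P.natDegree → originEval B ≠ 0) ∧
      ((E.q : L) ≠ 0 → (E.P.natDegree : L) ≠ 0 → originEval B = 0 →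
        (Polynomial.derivative (reduction B)).eval 0 ≠ 0) := by
  classical
  obtain ⟨a, U, hU, hφ⟩ := h.pull_phi
  set T := (Finset.range N).filter fun j => A j ≠ 0 with hT
  have hTne : T.Nonempty := by
    obtain ⟨j, hj, hj0⟩ := hA0
    exact ⟨j, Finset.mem_filter.2 ⟨hj, hj0⟩⟩
  choose! n hn using fun j (hj : A j ≠ 0) => h.isRegular (A j) hj (hA j)
  have hxφ : xVal (E.sigmaPull c (pull (φ k))) = (E.q * a + E.m : ℕ) := by
    rw [hφ]
    exact (E.isRegular_sigmaPull_X_mul hm hz hc a hU).xVal_eq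
  obtain ⟨w, B, hle, ⟨b, hb, hbw⟩, hsum, h1, h2⟩ := E.exists_sum_sigmaPull_eq hm hz hc hTne
    (A := fun j => pull (A j)) (n := n) (fun j hj => hn j (Finset.mem_filter.1 hj).2) a hU
    (fun j hj => by
      have := Finset.mem_range.1 (Finset.mem_filter.1 hj).1
      omega)
  have hval : ∀ j ∈ T, (E.q : ℕ∞) * xVal (pull (A j)) +
      j * xVal (E.sigmaPull c (pull (φ k))) = (E.q * n j + j * (E.q * a + E.m) : ℕ) := by
    intro j hj
    rw [(hn j (Finset.mem_filter.1 hj).2).xVal_eq, hxφ]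
    push_cast
    rfl
  refine ⟨w, B, ?_, le_antisymm ?_ ?_, fun hN' => h1 fun j hj => ?_, h2⟩
  · rw [← hsum, map_sum, map_sum, hT, Finset.sum_filter]
    refine Finset.sum_congr rfl fun j _ => ?_
    split_ifs with hj
    · rw [map_mul, map_mul, map_pow, map_pow, hφ]
    · rw [not_not.1 hj, zero_mul, map_zero, map_zero]
  · refine (Finset.inf_le (Finset.mem_filter.1 hb).1).trans ?_
    rw [hval b hb, hbw]
  · refine Finset.le_inf fun j hj => ?_
    by_cases hj0 : A j = 0
    · rw [hj0, map_zero, xVal_zero, ENat.mul_top (by exact_mod_cast E.q_pos.ne'), top_add]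
      exact le_top
    · have hjT : j ∈ T := Finset.mem_filter.2 ⟨hj, hj0⟩
      rw [hval j hjT]
      exact_mod_cast hle j hjT
  · exact (Finset.mem_range.1 (Finset.mem_filter.1 hj).1).trans_le hN'

lemma xVal_adic_sum (h : StageInvariant F φ r k pull H) (hm : E.m ≠ 0) (hz : E.z ≠ 0)
    {c : PowerSeries E.ResidueField} (hc : PowerSeries.constantCoeff c = 0)
    {A : ℕ → Polynomial (PowerSeries K)}
    (hA : ∀ j, (A j).degree < (∏ i ∈ Finset.range k, r i : ℕ)) :
    xVal (E.sigmaPull c (pull (∑ j ∈ Finset.range (E.q * E.P.natDegree), A j * φ k ^ j))) =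
      (Finset.range (E.q * E.P.natDegree)).inf fun j => (E.q : ℕ∞) * xVal (pull (A j)) +
        j * xVal (E.sigmaPull c (pull (φ k))) := by
  by_cases hA0 : ∃ j ∈ Finset.range (E.q * E.P.natDegree), A j ≠ 0
  · obtain ⟨w, B, h1, h2, h3, -⟩ := h.exists_pull_adic_sum_eq E hm hz hc (Nat.le_succ _) hA hA0
    rw [h2, h1, xVal_X_pow_mul _ (reduction_ne_zero_of_originEval (h3 le_rfl))]
  · push Not at hA0
    rw [Finset.sum_eq_zero fun j hj => by rw [hA0 j hj, zero_mul], map_zero, map_zero, xVal_zero,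
      eq_comm, ← top_le_iff]
    refine Finset.le_inf fun j hj => ?_
    rw [hA0 j hj, map_zero, xVal_zero, ENat.mul_top (by exact_mod_cast E.q_pos.ne'), top_add]

lemma baseHom_comp_sigmaPull (h : StageInvariant F φ r k pull H)
    (c : PowerSeries E.ResidueField) : baseHom ((E.sigmaPull c).comp pull) =
      (substX (AdjoinRoot.of E.P) (E.z ^ E.t) E.q E.q_pos.ne').comp (baseHom pull) := by
  ext1 a
  rw [baseHom, RingHom.comp_apply, RingHom.comp_apply, RingHom.comp_apply, h.pull_C]
  simp

/-- The invariants pass from one stage of the algorithm to the next one. The degree of `φ_{k+1}`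
is at most `∏ r_i` because the new ring of power series is generated by that many elements, and at
least `∏ r_i` because a polynomial of smaller degree has a regular pull-back, hence does not vanish
at the parametrisation. -/
theorem next (h : StageInvariant F φ r k pull H) (hsq : Squarefree F)
    (hchar : ∀ n : ℕ, 0 < n → n ≤ F.natDegree → (n : K) ≠ 0) (hH : H.natDegree ≠ 1)
    (hr : r k = E.q * E.P.natDegree)
    (hφ : φ (k + 1) = minpolyThrough (baseHom ((E.sigmaPull (shift E.next)).comp pull))
      (((E.sigmaPull (shift E.next)).comp pull Polynomial.X).coeff 0)) :
    StageInvariant F φ r (k + 1) ((E.sigmaPull (shift E.next)).comp pull)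
      (E.next.comp (Polynomial.X + C (shift E.next))) := by
  have hdegH := E.natDegree_eq h.isWeierstrass.1
  have hℓ : 0 < E.P.natDegree := E.irreducible.natDegree_pos
  have hqℓN : 0 < E.q * E.P.natDegree * E.N := Nat.mul_pos (Nat.mul_pos E.q_pos hℓ) E.N_pos
  have hH2 : H ≠ Polynomial.X ^ H.natDegree := h.ne_X_pow hsq (by omega)
  have hm := E.m_ne_zero h.isWeierstrass hH2
  have hz := E.z_ne_zero h.isWeierstrass hH2
  obtain ⟨hW, hle, nV, V, hV, hnext⟩ := E.exists_next h.isWeierstrass.1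
  have hc := hW.constantCoeff_shift
  set c := shift E.next
  have hqH : E.q ≤ H.natDegree := by
    rw [hdegH, mul_assoc]
    exact Nat.le_mul_of_pos_right _ (Nat.mul_pos hℓ E.N_pos)
  have hℓH : E.P.natDegree ≤ H.natDegree := by
    rw [hdegH, mul_comm E.q, mul_assoc]
    exact Nat.le_mul_of_pos_right _ (Nat.mul_pos E.q_pos E.N_pos)
  have hqL : (E.q : L) ≠ 0 := h.natCast_ne_zero hchar E.q_pos hqH
  have hℓL : (E.P.natDegree : L) ≠ 0 := h.natCast_ne_zero hchar hℓ hℓH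
  have hμ : E.z ^ E.t ≠ 0 := pow_ne_zero _ hz
  have hbase := h.baseHom_comp_sigmaPull E c
  have hregular : ∀ G : Polynomial (PowerSeries K), G ≠ 0 →
      G.degree < (∏ i ∈ Finset.range (k + 1), r i : ℕ) →
      ∃ n, IsRegular ((E.sigmaPull c).comp pull G) n := by
    intro G hG0 hG
    rw [Finset.prod_range_succ, hr] at hG
    obtain ⟨A, hA, rfl⟩ := exists_adic_expansion h.monic h.natDegree_eq _ G hG
    have hA0 : ∃ j ∈ Finset.range (E.q * E.P.natDegree), A j ≠ 0 := by
      by_contra hcon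
      push Not at hcon
      exact hG0 (Finset.sum_eq_zero fun j hj => by rw [hcon j hj, zero_mul])
    obtain ⟨w, B, h1, -, h3, -⟩ := h.exists_pull_adic_sum_eq E hm hz hc (Nat.le_succ _) hA hA0
    exact ⟨w, B, h1, h3 le_rfl⟩
  have hspan : IsSpannedBy (baseHom ((E.sigmaPull c).comp pull))
      (∏ i ∈ Finset.range (k + 1), r i) := by
    rw [hbase, Finset.prod_range_succ, hr, mul_comm E.q]
    exact (isSpannedBy_substX _ hμ _ (isSpannedBy_adjoinRoot E.monic)).comp h.isSpannedBy
  obtain ⟨hmonic, hdeg, hroot⟩ := minpolyThrough_spec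
    (hspan.exists_monic (((E.sigmaPull c).comp pull Polynomial.X).coeff 0))
    (fun p hp0 hp => by
      obtain ⟨n, hn⟩ := hregular p hp0 hp
      rw [← coeff_zero_pull_eq_eval₂]
      exact hn.coeff_zero_ne)
  rw [← hφ] at hmonic hdeg hroot
  rw [← coeff_zero_pull_eq_eval₂] at hroot
  have hxφ : ∀ i < k, xVal ((E.sigmaPull c).comp pull (φ i)) = E.q * xVal (pull (φ i)) := by
    intro i hi
    obtain ⟨n, hn⟩ := h.isRegular_phi i hi
    rw [RingHom.comp_apply, (E.isRegular_sigmaPull hm hz hn).xVal_eq, hn.xVal_eq]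
    push_cast
    rfl
  refine
    { pull_C := fun a => ?_
      order_baseHom := ?_
      isSpannedBy := hspan
      monic := hmonic
      natDegree_eq := hdeg
      pull_phi := ?_
      isRegular_phi := fun i hi => ?_
      isRegular := hregular
      degree_boxSum := fun a => ?_
      exists_boxSum := fun G hG => ?_
      xVal_boxSum := fun a => ?_
      isWeierstrass := hW.comp hc
      natDegree_le := ?_
      pull_eq := ?_ }
  · rw [RingHom.comp_apply, h.pull_C, EdgeData.sigmaPull_C, hbase, RingHom.comp_apply]
  · obtain ⟨e, he, hord⟩ := h.order_baseHom
    refine ⟨E.q * e, mul_ne_zero E.q_pos.ne' he, fun a => ?_⟩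
    rw [hbase, RingHom.comp_apply, order_substX _ _ _ _ hμ, hord, ← mul_assoc]
    push_cast
    rfl
  · have hdeg' : (φ (k + 1)).degree <
        ((∏ i ∈ Finset.range k, r i) * (E.q * E.P.natDegree + 1) : ℕ) := by
      rw [Polynomial.degree_eq_natDegree hmonic.ne_zero, hdeg, Finset.prod_range_succ, hr]
      exact_mod_cast Nat.mul_lt_mul_of_pos_left (Nat.lt_succ_self _) h.degree_phi_pos
    obtain ⟨A, hA, hsum⟩ := exists_adic_expansion h.monic h.natDegree_eq _ _ hdeg'
    have hA0 : ∃ j ∈ Finset.range (E.q * E.P.natDegree + 1), A j ≠ 0 := by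
      by_contra hcon
      push Not at hcon
      exact hmonic.ne_zero (hsum.trans (Finset.sum_eq_zero fun j hj => by rw [hcon j hj, zero_mul]))
    obtain ⟨w, B, h1, -, -, h4⟩ := h.exists_pull_adic_sum_eq E hm hz hc le_rfl hA hA0
    rw [← hsum] at h1
    rw [RingHom.comp_apply, h1, Polynomial.coeff_C_mul] at hroot
    have hB0 : B.coeff 0 = 0 :=
      (mul_eq_zero.1 hroot).resolve_left (pow_ne_zero _ PowerSeries.X_ne_zero)
    obtain ⟨U, rfl⟩ := Polynomial.X_dvd_iff.2 hB0
    refine ⟨w, U, ?_, h1⟩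
    -- `U(0, 0)` is the derivative in `y` at `0` of the leading form of `π_{k+1}^* φ_{k+1}`
    have h5 := h4 hqL hℓL (by simp)
    rw [← Polynomial.coeff_zero_eq_eval_zero, Polynomial.coeff_derivative, coeff_reduction,
      Polynomial.coeff_X_mul] at h5
    rw [originEval_apply]
    intro h6
    exact h5 (by simp [h6])
  · rcases Nat.lt_succ_iff_lt_or_eq.1 hi with hi | rfl
    · obtain ⟨n, hn⟩ := h.isRegular_phi i hi
      exact ⟨_, E.isRegular_sigmaPull hm hz hn⟩
    · obtain ⟨a, U, hU, hφi⟩ := h.pull_phi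
      rw [RingHom.comp_apply, hφi]
      exact ⟨_, E.isRegular_sigmaPull_X_mul hm hz hc a hU⟩
  · rw [boxSum_succ, Finset.prod_range_succ]
    exact degree_adic_sum_lt h.monic h.natDegree_eq fun j _ => h.degree_boxSum _
  · rw [Finset.prod_range_succ] at hG
    obtain ⟨A, hA, hsum⟩ := exists_adic_expansion h.monic h.natDegree_eq _ G hG
    choose a ha using fun j => h.exists_boxSum (A j) (hA j)
    refine ⟨fun b => a (b (Fin.last k)) (Fin.init b), ?_⟩
    rw [boxSum_succ, hsum]
    refine Finset.sum_congr rfl fun j _ => ?_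
    conv_lhs => rw [ha j]
    simp
  · rw [boxSum_succ, inf_box_succ, hr, RingHom.comp_apply,
      h.xVal_adic_sum E hm hz hc fun j => h.degree_boxSum _]
    refine Finset.inf_congr rfl fun j _ => ?_
    rw [h.xVal_boxSum, Finset.apply_inf_eq_inf_comp_of_linearOrder
      (fun x : ℕ∞ => (E.q : ℕ∞) * x + j * xVal (E.sigmaPull c (pull (φ k))))
      (fun x y hxy => by dsimp only; gcongr)
      (by rw [ENat.mul_top (by exact_mod_cast E.q_pos.ne'), top_add])]
    refine Finset.inf_congr rfl fun b _ => ?_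
    rw [Function.comp_apply, Fin.sum_univ_castSucc, hbase, RingHom.comp_apply,
      order_substX _ _ _ _ hμ, mul_add, Finset.mul_sum, add_assoc]
    congr 2
    · refine Finset.sum_congr rfl fun i _ => ?_
      rw [Fin.snoc_castSucc, Fin.val_castSucc, hxφ i i.2, mul_left_comm]
    · simp
  · rw [Polynomial.natDegree_comp, Polynomial.natDegree_X_add_C, mul_one]
    exact hle.trans h.natDegree_le
  · obtain ⟨v, V₀, hV₀, hF⟩ := h.pull_eq
    refine ⟨E.q * v + nV, C (PowerSeries.C (E.z ^ (E.t * v))) *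
      V.comp (Polynomial.X + C c) * E.sigmaPull c V₀, ?_, ?_⟩
    · rw [map_mul, map_mul, originEval_C, PowerSeries.constantCoeff_C,
        originEval_comp_X_add_C hc, E.originEval_sigmaPull c hm]
      exact mul_ne_zero (mul_ne_zero (pow_ne_zero _ hz) hV) ((map_ne_zero _).2 hV₀)
    · rw [RingHom.comp_apply, hF, map_mul, map_mul, EdgeData.sigmaPull_C_X_pow,
        ← E.comp_sigmaPull_zero c H, hnext, Polynomial.mul_comp, Polynomial.mul_comp,
        Polynomial.C_comp, pow_add, Polynomial.C_mul]
      ring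

end StageInvariant

end Invariant

/-! ### The stages of the algorithm -/

section Stages

variable {K : Type u} [Field K] {F : Polynomial (PowerSeries K)}

lemma stageInvariant_zero (hW : IsWeierstrass F) {φ : ℕ → Polynomial (PowerSeries K)} (r : ℕ → ℕ)
    (hφ : φ 0 = minpolyThrough
      (baseHom (Polynomial.compRingHom (Polynomial.X + C (shift F))))
      ((Polynomial.compRingHom (Polynomial.X + C (shift F)) Polynomial.X).coeff 0)) :
    StageInvariant F φ r 0 (Polynomial.compRingHom (Polynomial.X + C (shift F)))
      (F.comp (Polynomial.X + C (shift F))) := by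
  have hc := hW.constantCoeff_shift
  set c := shift F
  have hbase : baseHom (Polynomial.compRingHom (Polynomial.X + C c)) =
      RingHom.id (PowerSeries K) := by
    ext1 a
    simp [baseHom]
  have hspan : IsSpannedBy (baseHom (Polynomial.compRingHom (Polynomial.X + C c)))
      (∏ i ∈ Finset.range 0, r i) := by
    rw [hbase, Finset.prod_range_zero]
    exact ⟨fun _ => 1, fun s => ⟨fun _ => s, by simp⟩⟩
  have hregular : ∀ G : Polynomial (PowerSeries K), G ≠ 0 →
      G.degree < (∏ i ∈ Finset.range 0, r i : ℕ) →
      ∃ n, IsRegular (Polynomial.compRingHom (Polynomial.X + C c) G) n := by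
    intro G hG0 hG
    rw [Finset.prod_range_zero, ← Polynomial.natDegree_lt_iff_degree_lt hG0, Nat.lt_one_iff] at hG
    rw [Polynomial.eq_C_of_natDegree_eq_zero hG] at hG0 ⊢
    simpa using isRegular_C (Polynomial.C_ne_zero.1 hG0)
  obtain ⟨hmonic, hdeg, hroot⟩ := minpolyThrough_spec
    (hspan.exists_monic ((Polynomial.compRingHom (Polynomial.X + C c) Polynomial.X).coeff 0))
    (fun p hp0 hp => by
      obtain ⟨n, hn⟩ := hregular p hp0 hp
      rw [← coeff_zero_pull_eq_eval₂]
      exact hn.coeff_zero_ne)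
  rw [← hφ] at hmonic hdeg hroot
  rw [← coeff_zero_pull_eq_eval₂] at hroot
  refine
    { pull_C := fun a => by simp [hbase]
      order_baseHom := ⟨1, one_ne_zero, fun a => by simp [hbase]⟩
      isSpannedBy := hspan
      monic := hmonic
      natDegree_eq := hdeg
      pull_phi := ⟨0, 1, by simp, ?_⟩
      isRegular_phi := fun i hi => absurd hi (Nat.not_lt_zero i)
      isRegular := hregular
      degree_boxSum := fun a => ?_
      exists_boxSum := fun G hG => ⟨fun _ => G.coeff 0, ?_⟩
      xVal_boxSum := fun a => ?_
      isWeierstrass := hW.comp hc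
      natDegree_le := by
        rw [Polynomial.natDegree_comp, Polynomial.natDegree_X_add_C, mul_one]
      pull_eq := ⟨0, 1, by simp, by simp⟩ }
  · rw [hmonic.eq_X_add_C (by simpa using hdeg)] at hroot ⊢
    have h : c + (φ 0).coeff 0 = 0 := by simpa using hroot
    simp [add_assoc, ← Polynomial.C_add, h]
  · simpa [boxSum, box] using lt_of_le_of_lt Polynomial.degree_C_le
      (WithBot.coe_lt_coe.2 zero_lt_one)
  · rcases eq_or_ne G 0 with rfl | hG0
    · simp [boxSum, box]
    · rw [Finset.prod_range_zero, ← Polynomial.natDegree_lt_iff_degree_lt hG0,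
        Nat.lt_one_iff] at hG
      simpa [boxSum, box] using Polynomial.eq_C_of_natDegree_eq_zero hG
  · simp [boxSum, box, hbase, xVal_C]

/-- The minimal polynomial of the parametrisation attached to a stage. -/
def Stage.phi (S : Stage K) : Polynomial (PowerSeries K) :=
  minpolyThrough (baseHom S.pull) ((S.pull Polynomial.X).coeff 0)

lemma phi_eq (F : Polynomial (PowerSeries K)) (k : ℕ) :
    NewtonPuiseux.phi F k = (stage F k).phi := by
  rw [Stage.phi, Polynomial.coeff_zero_eq_eval_zero]
  rfl

theorem stageInvariant (hW : IsWeierstrass F) (hsq : Squarefree F)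
    (hchar : ∀ n : ℕ, 0 < n → n ≤ F.natDegree → (n : K) ≠ 0) {k : ℕ}
    (hk : ∀ i < k, ¬ StopsAt F i) :
    StageInvariant F (phi F) (fun i => (stage F i).qℓ) k (stage F k).pull (stage F k).H := by
  induction k with
  | zero => exact stageInvariant_zero hW _ (phi_eq F 0)
  | succ k ih =>
    have hinv := ih fun i hi => hk i (hi.trans (Nat.lt_succ_self k))
    obtain ⟨h1, h2⟩ := not_or.1 (hk k (Nat.lt_succ_self k))
    have hE : Nonempty (EdgeData (stage F k).H) := not_not.1 h2
    have hsucc : stage F (k + 1) = (stage F k).transform hE.some := dif_pos hE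
    have hφ : phi F (k + 1) = ((stage F k).transform hE.some).phi := by rw [phi_eq, hsucc]
    rw [hsucc]
    exact hinv.next hE.some hsq hchar h1 (dif_pos hE) hφ

end Stages

/-! ### Expansions and the Newton polygon -/

section Expansion

variable {K : Type u} [Field K] {F : Polynomial (PowerSeries K)} {k : ℕ}

/-- The power series in `x` that collects the coefficients of an expansion with a given tail. -/
def tailSeries (f : (Fin (k + 2) → ℕ) → K) (b : Fin (k + 1) → ℕ) : PowerSeries K :=
  PowerSeries.mk fun n => f (Fin.cons n b)

/-- The coefficient of `φ_k^i` in an expansion. -/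
def phiCoeff (F : Polynomial (PowerSeries K)) (f : (Fin (k + 2) → ℕ) → K) (i : ℕ) :
    Polynomial (PowerSeries K) :=
  boxSum (phi F) (fun i => (stage F i).qℓ) k
    fun b => tailSeries f (Fin.snoc (α := fun _ => ℕ) b i)

lemma tailSeries_ne_zero_iff {f : (Fin (k + 2) → ℕ) → K} {b : Fin (k + 1) → ℕ} :
    tailSeries f b ≠ 0 ↔ ∃ n : ℕ, f (Fin.cons n b) ≠ 0 := by
  rw [Ne, PowerSeries.ext_iff, not_forall]
  simp [tailSeries]

lemma cons_mem_exponents_iff {n : ℕ} {b : Fin (k + 1) → ℕ} :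
    (Fin.cons n b : Fin (k + 2) → ℕ) ∈ exponents F k ↔
      ∀ i : Fin k, b i.castSucc < (stage F i).qℓ := by
  simp only [exponents, Set.mem_ofPred_eq]
  refine forall_congr' fun i => ?_
  rw [← Fin.succ_castSucc, Fin.cons_succ]

/-- The sum over all tails, arranged as an expansion in powers of the last polynomial. -/
lemma finsum_eq_sum_boxSum {R : Type*} [CommRing R] (φ : ℕ → Polynomial R) (r : ℕ → ℕ) {N : ℕ}
    (a : (Fin (k + 1) → ℕ) → R)
    (ha : ∀ b, a b ≠ 0 → (∀ i : Fin k, b i.castSucc < r i) ∧ b (Fin.last k) < N) :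
    ∑ᶠ b : Fin (k + 1) → ℕ, C (a b) * ∏ i : Fin (k + 1), φ i ^ b i =
      ∑ i ∈ Finset.range N,
        boxSum φ r k (fun b => a (Fin.snoc (α := fun _ => ℕ) b i)) * φ k ^ i := by
  classical
  set r' := Function.update r k N with hr'
  have hbox : box r' k = box r k := by
    ext b
    rw [mem_box, mem_box]
    refine forall_congr' fun i => ?_
    rw [hr', Function.update_of_ne i.2.ne]
  have h := boxSum_succ φ r' k a
  have hrk : r' k = N := Function.update_self _ _ _
  rw [hrk] at h
  simp only [boxSum, hbox] at h ⊢
  rw [← h]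
  refine finsum_eq_sum_of_support_subset _ fun b hb => ?_
  have hab : a b ≠ 0 := by
    intro h0
    exact hb (by simp [h0])
  obtain ⟨h1, h2⟩ := ha b hab
  rw [Finset.mem_coe, mem_box]
  refine Fin.lastCases ?_ fun i => ?_
  · rwa [Fin.val_last, hrk]
  · rw [Fin.val_castSucc, hr', Function.update_of_ne i.2.ne]
    exact h1 i

lemma IsPhiAdicExpansion.exists_eq_sum {f : (Fin (k + 2) → ℕ) → K}
    (hf : IsPhiAdicExpansion F k f) :
    ∃ N₀, (∀ i, N₀ ≤ i → phiCoeff F f i = 0) ∧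
      ∀ N, N₀ ≤ N → F = ∑ i ∈ Finset.range N, phiCoeff F f i * phi F k ^ i := by
  obtain ⟨N₀, hN₀⟩ := (hf.finite.image fun b => b (Fin.last k)).bddAbove
  have hlt : ∀ b, tailSeries f b ≠ 0 → b (Fin.last k) < N₀ + 1 := by
    intro b hb
    exact Nat.lt_succ_of_le (hN₀ ⟨b, tailSeries_ne_zero_iff.1 hb, rfl⟩)
  refine ⟨N₀ + 1, fun i hi => ?_, fun N hN => ?_⟩
  · refine Finset.sum_eq_zero fun b _ => ?_
    have : tailSeries f (Fin.snoc (α := fun _ => ℕ) b i) = 0 := by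
      by_contra hne
      have := hlt _ hne
      rw [Fin.snoc_last] at this
      omega
    beta_reduce
    rw [this, map_zero, zero_mul]
  · have h := hf.sum_eq
    simp only [Phi, Fin.cons_succ] at h
    conv_lhs => rw [h]
    refine finsum_eq_sum_boxSum (phi F) _ (tailSeries f) fun b hb => ⟨?_, (hlt b hb).trans_le hN⟩
    obtain ⟨n, hn⟩ := tailSeries_ne_zero_iff.1 hb
    exact cons_mem_exponents_iff.1 (hf.support _ hn)

lemma boxSum_sub {R : Type*} [CommRing R] (φ : ℕ → Polynomial R) (r : ℕ → ℕ) (k : ℕ)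
    (a a' : (Fin k → ℕ) → R) : boxSum φ r k (a - a') = boxSum φ r k a - boxSum φ r k a' := by
  simp only [boxSum, ← Finset.sum_sub_distrib, Pi.sub_apply, map_sub, sub_mul]

section

variable (h : StageInvariant F (phi F) (fun i => (stage F i).qℓ) k (stage F k).pull (stage F k).H)

include h

lemma StageInvariant.xVal_phi_ne_top (i : Fin (k + 1)) :
    xVal ((stage F k).pull (phi F i)) ≠ ⊤ := by
  refine Fin.lastCases ?_ (fun i => ?_) i
  · obtain ⟨a, U, hU, hφ⟩ := h.pull_phi
    rw [Fin.val_last, hφ, xVal_X_pow_mul]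
    · exact ENat.natCast_ne_top a
    · rw [map_mul, reduction_X]
      exact mul_ne_zero Polynomial.X_ne_zero (reduction_ne_zero_of_originEval hU)
  · obtain ⟨n, hn⟩ := h.isRegular_phi i i.2
    rw [Fin.val_castSucc, hn.xVal_eq]
    exact ENat.natCast_ne_top n

/-- The `Φ`-adic expansions are unique because the valuation of a sum is the least one of its
terms: a vanishing sum has vanishing terms. -/
lemma StageInvariant.boxSum_eq_zero {a : (Fin k → ℕ) → PowerSeries K}
    (h0 : boxSum (phi F) (fun i => (stage F i).qℓ) k a = 0) :
    ∀ b ∈ box (fun i => (stage F i).qℓ) k, a b = 0 := by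
  intro b hb
  have h1 := h.xVal_boxSum a
  rw [h0, map_zero, xVal_zero, eq_comm, Finset.inf_eq_top_iff] at h1
  have h2 := h1 b hb
  rw [ENat.add_eq_top] at h2
  have h3 : ∑ i : Fin k, (b i : ℕ∞) * xVal ((stage F k).pull (phi F i)) ≠ ⊤ := by
    exact ENat.sum_ne_top.2 fun i _ =>
      WithTop.mul_ne_top (ENat.natCast_ne_top _) (h.xVal_phi_ne_top i.castSucc)
  obtain ⟨e, he, hord⟩ := h.order_baseHom
  have h4 := h2.resolve_right h3
  rw [hord] at h4
  rw [← PowerSeries.order_eq_top]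
  by_contra hne
  exact WithTop.mul_ne_top (ENat.natCast_ne_top e) hne h4

lemma StageInvariant.existsUnique_expansion :
    ∃! f : (Fin (k + 2) → ℕ) → K, IsPhiAdicExpansion F k f := by
  classical
  have hex : ∃ f : (Fin (k + 2) → ℕ) → K, IsPhiAdicExpansion F k f := by
    set d := ∏ i ∈ Finset.range k, (stage F i).qℓ with hd
    set N := F.natDegree + 1 with hN
    obtain ⟨A, hA, hF⟩ := exists_adic_expansion h.monic h.natDegree_eq N F
      (Polynomial.degree_le_natDegree.trans_lt
        (by exact_mod_cast (Nat.lt_succ_self _).trans_le (Nat.le_mul_of_pos_left N h.degree_phi_pos)))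
    choose a ha using fun j => h.exists_boxSum (A j) (hA j)
    set f : (Fin (k + 2) → ℕ) → K := fun B =>
      if B ∈ exponents F k ∧ B (Fin.last (k + 1)) < N then
        PowerSeries.coeff (B 0) (a (B (Fin.last (k + 1))) (Fin.init (Fin.tail B))) else 0 with hf
    have hsupp : ∀ b, tailSeries f b ≠ 0 →
        (∀ i : Fin k, b i.castSucc < (stage F i).qℓ) ∧ b (Fin.last k) < N := by
      intro b hb
      obtain ⟨n, hn⟩ := tailSeries_ne_zero_iff.1 hb
      have h1 : (Fin.cons n b : Fin (k + 2) → ℕ) ∈ exponents F k ∧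
          (Fin.cons n b : Fin (k + 2) → ℕ) (Fin.last (k + 1)) < N := by
        by_contra hcon
        exact hn (if_neg hcon)
      rw [cons_mem_exponents_iff, ← Fin.succ_last, Fin.cons_succ] at h1
      exact h1
    refine ⟨f, fun B hB => ?_, ?_, ?_⟩
    · by_contra hcon
      exact hB (if_neg fun h => hcon h.1)
    · refine ((box (Function.update (fun i => (stage F i).qℓ) k N)
        (k + 1)).finite_toSet).subset fun b hb => ?_
      obtain ⟨h1, h2⟩ := hsupp b (tailSeries_ne_zero_iff.2 hb)
      rw [Finset.mem_coe, mem_box]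
      refine Fin.lastCases ?_ fun i => ?_
      · rwa [Fin.val_last, Function.update_self]
      · rw [Fin.val_castSucc, Function.update_of_ne i.2.ne]
        exact h1 i
    · simp only [Phi, Fin.cons_succ]
      refine Eq.trans ?_ (finsum_eq_sum_boxSum (phi F) (fun i => (stage F i).qℓ) (N := N)
        (tailSeries f) hsupp).symm
      conv_lhs => rw [hF]
      refine Finset.sum_congr rfl fun j hj => ?_
      congr 1
      conv_lhs => rw [ha j]
      refine Finset.sum_congr rfl fun b hb => ?_
      congr 2
      ext n
      beta_reduce
      rw [tailSeries, PowerSeries.coeff_mk, hf]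
      beta_reduce
      rw [if_pos]
      · rw [← Fin.succ_last, Fin.cons_succ, Fin.snoc_last, Fin.cons_zero, Fin.tail_cons,
          Fin.init_snoc]
      · rw [cons_mem_exponents_iff, ← Fin.succ_last, Fin.cons_succ, Fin.snoc_last]
        exact ⟨fun i => by simpa using mem_box.1 hb i, Finset.mem_range.1 hj⟩
  obtain ⟨f, hf⟩ := hex
  refine ⟨f, hf, fun f' hf' => ?_⟩
  obtain ⟨N₁, hN₁, hsum₁⟩ := hf.exists_eq_sum
  obtain ⟨N₂, hN₂, hsum₂⟩ := hf'.exists_eq_sum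
  ext B
  by_cases hB : B ∈ exponents F k
  swap
  · rw [not_not.1 fun h0 => hB (hf.support B h0), not_not.1 fun h0 => hB (hf'.support B h0)]
  obtain ⟨n, b, rfl⟩ : ∃ n b, B = (Fin.cons n b : Fin (k + 2) → ℕ) :=
    ⟨B 0, Fin.tail B, (Fin.cons_self_tail B).symm⟩
  obtain ⟨b, i, rfl⟩ : ∃ b' i, b = Fin.snoc (α := fun _ => ℕ) b' i :=
    ⟨Fin.init b, b (Fin.last k), (Fin.snoc_init_self b).symm⟩
  rw [cons_mem_exponents_iff] at hB
  set N := max (max N₁ N₂) (i + 1) with hN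
  have hdiff : ∑ j ∈ Finset.range N, (phiCoeff F f' j - phiCoeff F f j) * phi F k ^ j = 0 := by
    simp only [sub_mul, Finset.sum_sub_distrib]
    rw [← hsum₁ N (by omega), ← hsum₂ N (by omega), sub_self]
  simp only [phiCoeff, ← boxSum_sub] at hdiff
  have h1 := h.boxSum_eq_zero (adic_expansion_unique h.monic h.natDegree_eq
    (fun j _ => h.degree_boxSum _) hdiff i (Finset.mem_range.2 (by omega))) b
    (mem_box.2 fun i => by simpa using hB i)
  rw [Pi.sub_apply, sub_eq_zero] at h1
  have h2 := congrArg (PowerSeries.coeff n) h1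
  simpa [tailSeries] using h2

/-- The exponents with `b_k = i` compute the valuation of the coefficient of `φ_k^i`. -/
lemma StageInvariant.iInf_scalarV {f : (Fin (k + 2) → ℕ) → K} (hf : IsPhiAdicExpansion F k f)
    (i : ℕ) : ⨅ B ∈ {B : Fin (k + 2) → ℕ | B (Fin.last (k + 1)) = i ∧ f B ≠ 0}, scalarV F k B =
      xVal ((stage F k).pull (phiCoeff F f i)) + i * xVal ((stage F k).pull (phi F k)) := by
  obtain ⟨e, he, hord⟩ := h.order_baseHom
  have hscalar : ∀ (n : ℕ) (b : Fin k → ℕ),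
      scalarV F k (Fin.cons n (Fin.snoc (α := fun _ => ℕ) b i)) =
        (e : ℕ∞) * n + ∑ l : Fin k, (b l : ℕ∞) * xVal ((stage F k).pull (phi F l)) +
          i * xVal ((stage F k).pull (phi F k)) := by
    intro n b
    rw [scalarV, Fin.sum_univ_succ, Fin.sum_univ_castSucc]
    simp only [Fin.cons_zero, Fin.cons_succ, Fin.snoc_castSucc, Fin.snoc_last, Phi, v,
      Fin.val_castSucc, Fin.val_last, h.pull_C, xVal_C, hord, PowerSeries.order_X, mul_one]
    rw [add_assoc, mul_comm (n : ℕ∞)]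
  rw [phiCoeff, h.xVal_boxSum, Finset.apply_inf_eq_inf_comp_of_linearOrder
    (fun x : ℕ∞ => x + i * xVal ((stage F k).pull (phi F k)))
    (fun x y hxy => by dsimp only; gcongr) (top_add _)]
  apply le_antisymm
  · refine Finset.le_inf fun b _ => ?_
    rw [Function.comp_apply, hord]
    rcases eq_or_ne (tailSeries f (Fin.snoc (α := fun _ => ℕ) b i)) 0 with h0 | h0
    · rw [h0, PowerSeries.order_zero, ENat.mul_top (by exact_mod_cast he), top_add, top_add]
      exact le_top
    · have hcoeff := PowerSeries.coeff_order h0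
      rw [← PowerSeries.coe_toNat_order h0, ← hscalar]
      refine iInf₂_le _ ⟨?_, ?_⟩
      · rw [← Fin.succ_last, Fin.cons_succ, Fin.snoc_last]
      · rwa [tailSeries, PowerSeries.coeff_mk] at hcoeff
  · refine le_iInf₂ ?_
    rintro B ⟨hBi, hB⟩
    obtain ⟨n, b, rfl⟩ : ∃ n b, B = (Fin.cons n b : Fin (k + 2) → ℕ) :=
      ⟨B 0, Fin.tail B, (Fin.cons_self_tail B).symm⟩
    obtain ⟨b, j, rfl⟩ : ∃ b' j, b = Fin.snoc (α := fun _ => ℕ) b' j :=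
      ⟨Fin.init b, b (Fin.last k), (Fin.snoc_init_self b).symm⟩
    rw [← Fin.succ_last, Fin.cons_succ, Fin.snoc_last] at hBi
    subst hBi
    have hb := cons_mem_exponents_iff.1 (hf.support _ hB)
    refine (Finset.inf_le (mem_box.2 fun l => by simpa using hb l)).trans ?_
    rw [Function.comp_apply, hscalar, hord]
    gcongr
    refine PowerSeries.order_le n ?_
    rwa [tailSeries, PowerSeries.coeff_mk]

lemma StageInvariant.newtonPolygon_eq {f : (Fin (k + 2) → ℕ) → K}
    (hf : IsPhiAdicExpansion F k f) :
    newtonPolygon (stage F k).H =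
      lowerConvexHull (graphPoints (stage F k).H.natDegree (w F k f)) := by
  classical
  set H := (stage F k).H with hH
  set n := H.natDegree with hn
  obtain ⟨N, hN, hsum⟩ := hf.exists_eq_sum
  obtain ⟨a, U, hU, hφ⟩ := h.pull_phi
  obtain ⟨v₀, V, hV, hpull⟩ := h.pull_eq
  have hxφ : xVal ((stage F k).pull (phi F k)) = a := by
    rw [hφ, xVal_X_pow_mul]
    rw [map_mul, reduction_X]
    exact mul_ne_zero Polynomial.X_ne_zero (reduction_ne_zero_of_originEval hU)
  have hv : v F k F = v₀ := by
    rw [v, hpull, xVal_X_pow_mul]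
    rw [map_mul, h.isWeierstrass.reduction_eq]
    exact mul_ne_zero (pow_ne_zero _ Polynomial.X_ne_zero) (reduction_ne_zero_of_originEval hV)
  -- the presentation of `π_k^* F` that comes from the expansion
  set T₁ := (Finset.range N).filter fun i => phiCoeff F f i ≠ 0 with hT₁
  have hmem₁ : ∀ i, i ∈ T₁ ↔ phiCoeff F f i ≠ 0 := by
    intro i
    rw [hT₁, Finset.mem_filter, Finset.mem_range, and_iff_right_iff_imp]
    intro hi
    by_contra hc
    exact hi (hN i (not_lt.1 hc))
  choose! m hm using fun i (hi : phiCoeff F f i ≠ 0) =>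
    h.isRegular (phiCoeff F f i) hi (h.degree_boxSum _)
  choose! W hW hW0 using hm
  have hF₁ : (stage F k).pull F = ∑ i ∈ T₁, C (PowerSeries.X ^ (m i + a * i)) *
      (Polynomial.X ^ i * (W i * U ^ i)) := by
    refine (congrArg (stage F k).pull (hsum N le_rfl)).trans ?_
    rw [map_sum, hT₁, Finset.sum_filter]
    refine Finset.sum_congr rfl fun i _ => ?_
    split_ifs with hi
    · rw [map_mul, map_pow, hφ, hW i hi, pow_add, Polynomial.C_mul, pow_mul,
        Polynomial.C_pow (a := PowerSeries.X ^ a)]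
      ring
    · rw [not_not.1 hi, zero_mul, map_zero]
  -- the presentation of `π_k^* F` that comes from its factor `H`
  choose! m' hm' b hb hb0 using fun i (hi : H.coeff i ≠ 0) => exists_eq_X_pow_mul hi
  have hF₂ : (stage F k).pull F = ∑ i ∈ H.support, C (PowerSeries.X ^ (v₀ + m' i)) *
      (Polynomial.X ^ i * (C (b i) * V)) := by
    rw [hpull]
    conv_lhs => rw [H.as_sum_support_C_mul_X_pow]
    rw [Finset.sum_mul, Finset.mul_sum]
    refine Finset.sum_congr rfl fun i hi => ?_
    conv_lhs => rw [hb i (Polynomial.mem_support_iff.1 hi)]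
    rw [pow_add, Polynomial.C_mul, Polynomial.C_mul]
    ring
  -- the two presentations have the same running minima
  have hiff : ∀ i t, (∀ j ∈ T₁, j ≤ i → t ≤ m j + a * j) ↔
      ∀ j ∈ H.support, j ≤ i → t ≤ v₀ + m' j := by
    intro i t
    rw [← forall_le_order_iff T₁ (fun i => m i + a * i) (fun i => W i * U ^ i) (fun j hj => by
        rw [map_mul, map_pow]
        exact mul_ne_zero (hW0 j ((hmem₁ j).1 hj)) (pow_ne_zero _ hU)) i t, ← hF₁, hF₂,
      forall_le_order_iff H.support (fun i => v₀ + m' i) (fun i => C (b i) * V) (fun j hj => by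
        rw [map_mul, originEval_C]
        exact mul_ne_zero (hb0 j (Polynomial.mem_support_iff.1 hj)) hV) i t]
  have h12 : ∀ i ∈ T₁, ∃ j ∈ H.support, j ≤ i ∧ v₀ + m' j ≤ m i + a * i := by
    intro i hi
    by_contra hcon
    push Not at hcon
    have := (hiff i (m i + a * i + 1)).2 (fun j hj hji => hcon j hj hji) i hi le_rfl
    omega
  have h21 : ∀ i ∈ H.support, ∃ j ∈ T₁, j ≤ i ∧ m j + a * j ≤ v₀ + m' i := by
    intro i hi
    by_contra hcon
    push Not at hcon
    have := (hiff i (v₀ + m' i + 1)).1 (fun j hj hji => hcon j hj hji) i hi le_rfl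
    omega
  have hnsupp : n ∈ H.support := by
    rw [Polynomial.mem_support_iff, hn, Polynomial.coeff_natDegree,
      h.isWeierstrass.1.leadingCoeff]
    exact one_ne_zero
  have hm'n : m' n = 0 := by
    have h1 := hm' n (Polynomial.mem_support_iff.1 hnsupp)
    rw [hn, Polynomial.coeff_natDegree, h.isWeierstrass.1.leadingCoeff,
      PowerSeries.order_one] at h1
    exact_mod_cast h1.symm
  have hm'0 : ∀ j ∈ H.support, m' j = 0 → j = n := by
    intro j hj hj0
    by_contra hne
    have hlt : j < n := lt_of_le_of_ne (Polynomial.le_natDegree_of_mem_supp j hj) hne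
    have hj' := Polynomial.mem_support_iff.1 hj
    refine hb0 j hj' ?_
    have := h.isWeierstrass.2 j hlt
    rwa [hb j hj', hj0, pow_zero, one_mul] at this
  have hnT : n ∈ T₁ ∧ m n + a * n = v₀ := by
    obtain ⟨j, hj, hjn, hle⟩ := h21 n hnsupp
    obtain ⟨j', hj', hjj', hle'⟩ := h12 j hj
    have h1 := hm'0 j' hj' (by omega)
    have h2 : j = n := by omega
    subst h2
    exact ⟨hj, by omega⟩
  -- the points on both sides, in terms of the exponents of `x`
  have hpts₁ : ∀ p, p ∈ graphPoints n (w F k f) ↔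
      ∃ i ≤ n, i ∈ T₁ ∧ p = ((i : ℝ), ((m i + a * i : ℕ) : ℝ) - v₀) := by
    have hw : ∀ i, w F k f i = if i ∈ T₁ then
        ((((m i + a * i : ℕ) : ℤ) - (v₀ : ℤ) : ℤ) : WithTop ℤ) else (⊤ : WithTop ℤ) := by
      intro i
      rw [w, h.iInf_scalarV hf, hv, hxφ, ENat.toNat_natCast]
      split_ifs with hi
      · have hr : IsRegular ((stage F k).pull (phiCoeff F f i)) (m i) :=
          ⟨W i, hW i ((hmem₁ i).1 hi), hW0 i ((hmem₁ i).1 hi)⟩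
        rw [hr.xVal_eq, mul_comm]
        rw [show (m i : ℕ∞) + (a : ℕ∞) * i = ((m i + a * i : ℕ) : ℕ∞) by push_cast; rfl,
          ENat.map_natCast]
      · rw [hmem₁, not_not] at hi
        rw [hi, map_zero, xVal_zero, top_add, ENat.map_top]
    intro p
    constructor
    · rintro ⟨i, hi, j, hj, rfl⟩
      rw [hw] at hj
      split_ifs at hj with hiT
      · refine ⟨i, hi, hiT, ?_⟩
        rw [← WithTop.coe_injective hj]
        push_cast
        rfl
      · exact absurd hj (by simp)
    · rintro ⟨i, hi, hiT, rfl⟩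
      refine ⟨i, hi, ((m i + a * i : ℕ) : ℤ) - (v₀ : ℤ), ?_, ?_⟩
      · rw [hw, if_pos hiT]
      · push_cast
        rfl
  have hpts₂ : ∀ p, p ∈ newtonPoints H ↔ ∃ i ∈ H.support, p = ((i : ℝ), (m' i : ℝ)) := by
    intro p
    rw [mem_newtonPoints_iff]
    constructor
    · rintro ⟨i, _, l, hl, rfl⟩
      have hi0 : H.coeff i ≠ 0 := by
        intro h0
        rw [h0, PowerSeries.order_zero] at hl
        exact absurd hl (by simp)
      refine ⟨i, Polynomial.mem_support_iff.2 hi0, ?_⟩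
      rw [hm' i hi0] at hl
      have : m' i = l := by exact_mod_cast hl
      rw [this]
    · rintro ⟨i, hi, rfl⟩
      exact ⟨i, Polynomial.le_natDegree_of_mem_supp i hi, m' i,
        hm' i (Polynomial.mem_support_iff.1 hi), rfl⟩
  refine lowerConvexHull_eq_of_forall_exists (fun p hp => ?_) (fun p hp => ?_)
  · obtain ⟨i, hi, rfl⟩ := (hpts₂ p).1 hp
    obtain ⟨j, hj, hji, hle⟩ := h21 i hi
    obtain ⟨j', hj', -, hle'⟩ := h12 j hj
    have hin := Polynomial.le_natDegree_of_mem_supp i hi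
    have h1 : ((m j + a * j : ℕ) : ℝ) ≤ v₀ + m' i := by exact_mod_cast hle
    have h2 : (v₀ : ℝ) ≤ ((m j + a * j : ℕ) : ℝ) := by
      exact_mod_cast (Nat.le_add_right _ _).trans hle'
    refine exists_le_mem_convexHull (n := n) ((hpts₁ _).2 ⟨n, le_rfl, hnT.1, ?_⟩)
      ((hpts₁ _).2 ⟨j, hji.trans hin, hj, rfl⟩) ?_ ?_ ?_ ?_
    · rw [hnT.2, sub_self]
    · exact Nat.cast_le.2 hji
    · simp only
      linarith
    · exact Nat.cast_le.2 hin
    · simp only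
      linarith
  · obtain ⟨i, hi, hiT, rfl⟩ := (hpts₁ p).1 hp
    obtain ⟨j, hj, hji, hle⟩ := h12 i hiT
    have h1 : (v₀ : ℝ) + m' j ≤ ((m i + a * i : ℕ) : ℝ) := by exact_mod_cast hle
    refine exists_le_mem_convexHull (n := n) ((hpts₂ _).2 ⟨n, hnsupp, ?_⟩)
      ((hpts₂ _).2 ⟨j, hj, rfl⟩) ?_ ?_ ?_ ?_
    · rw [hm'n, Nat.cast_zero]
    · exact Nat.cast_le.2 hji
    · simp only
      linarith
    · exact Nat.cast_le.2 hi
    · positivity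

end

end Expansion

end

end NewtonPuiseux

theorem mainTheorem3 {K : Type u} [Field K] [PerfectField K]
    (F : Polynomial (PowerSeries K)) (hW : NewtonPuiseux.IsWeierstrass F)
    (hsq : Squarefree F) (hchar : ringChar K = 0 ∨ F.natDegree < ringChar K)
    (k : ℕ) (hk : ∀ i < k, ¬ NewtonPuiseux.StopsAt F i)
    (hN : 1 < (NewtonPuiseux.transform F k).natDegree) :
    (∃! f : (Fin (k + 2) → ℕ) → K, NewtonPuiseux.IsPhiAdicExpansion F k f) ∧
    ∀ f : (Fin (k + 2) → ℕ) → K, NewtonPuiseux.IsPhiAdicExpansion F k f →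
      NewtonPuiseux.newtonPolygon (NewtonPuiseux.transform F k) =
        NewtonPuiseux.lowerConvexHull
          (NewtonPuiseux.graphPoints (NewtonPuiseux.transform F k).natDegree
            (NewtonPuiseux.w F k f)) := by
  have hcast : ∀ n : ℕ, 0 < n → n ≤ F.natDegree → (n : K) ≠ 0 := by
    intro n hn hle h0
    have hdvd := (ringChar.spec K n).1 h0
    rcases hchar with h | h
    · rw [h, zero_dvd_iff] at hdvd
      omega
    · have := Nat.le_of_dvd hn hdvd
      omega
  have h := NewtonPuiseux.stageInvariant hW hsq hcast hk
  exact ⟨h.existsUnique_expansion, fun f hf => h.newtonPolygon_eq hf⟩
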